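/- Let $\mathbb{B}=\{q\in\mathbb{H}:|q|<1\}$ be the open unit ball of the quaternions, and let $\mathrm{Sp}(1,1)=\{A\in M_2(\mathbb{H}) : A^*I_{1,1}A=I_{1,1}\}$, $I_{1,1}=\operatorname{diag}(1,-1)$, which is a Lie group and an embedded submanifold of $M_2(\mathbb{H})$ of dimension $10$. For functions $f(q)=\sum_n q^na_n$, $g(q)=\sum_n q^nb_n$ given by power series on $\mathbb{B}$, put $(f*g)(q)=\sum_n q^n\sum_{k=0}^n a_kb_{n-k}$, $f^c(q)=\sum_n q^n\overline{a_n}$, $f^s=f*f^c$ and $f^{-*}=(f^s)^{-1}f^c$. For $A=\begin{pmatrix}a&c\\ b&d\end{pmatrix}\in\mathrm{Sp}(1,1)$ the (slice) regular Möbius transformation $\mathcal{F}_A:\mathbb{B}\to\mathbb{B}$ is $$\mathcal{F}_A(q)=(qc+d)^{-*}*(qa+b),$$ which is a well-defined bijection of $\mathbb{B}$. Let $\mathcal{M}(\mathbb{B})=\{\mathcal{F}_A:A\in\mathrm{Sp}(1,1)\}$ carry the quotient topology and the unique ($7$-dimensional) smooth manifold structure for which $\mathrm{Sp}(1,1)\to\mathcal{M}(\mathbb{B})$,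 $A\mapsto\mathcal{F}_{A^{-1}}$, is a submersion. (Equivalently, the structure carried over from the homogeneous space $\mathrm{Sp}(1,1)/\mathrm{Sp}(1)I_2$ by the bijection $A\,\mathrm{Sp}(1)I_2\mapsto\mathcal{F}_{A^{-1}}$; here $\mathrm{Sp}(1)$ is the group of unit quaternions.) A submersion is a surjective smooth map whose differential is surjective at every point. Let $\mathcal{M}(\mathbb{B})_0=\{\mathcal{F}\in\mathcal{M}(\mathbb{B}):\mathcal{F}(0)=0\}$. It is a group under composition of maps, an embedded $3$-dimensional submanifold of $\mathcal{M}(\mathbb{B})$ and a Lie group with this structure, and $(\mathcal{F}_0,\mathcal{F})\mapsto\mathcal{F}_0\circ\mathcal{F}$ is a smooth, free and proper left action of $\mathcal{M}(\mathbb{B})_0$ on $\mathcal{M}(\mathbb{B})$ (proper: for every compact $K\subset\mathcal{M}(\mathbb{B})$ the set $\{g\in\mathcal{M}(\mathbb{B})_0 : gK\cap K\neq\emptyset\}$ is compact). The orbit space $\mathcal{M}(\mathbb{B})_0\backslash\mathcal{M}(\mathbb{B})$, with the quotient topology, has a unique ($4$-dimensional) smooth manifold structure for which the projection $\mathcal{F}\mapsto\mathcal{M}(\mathbb{B})_0\mathcal{F}$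 is a submersion. **Theorem.** The inverse orbit map $\mathcal{M}(\mathbb{B})\to\mathbb{B}$, $\mathcal{F}\mapsto\mathcal{F}^{-1}(0)$, is smooth, and it induces a well-defined map $$\mathcal{M}(\mathbb{B})_0\backslash\mathcal{M}(\mathbb{B})\to\mathbb{B},\qquad \mathcal{M}(\mathbb{B})_0\mathcal{F}\mapsto\mathcal{F}^{-1}(0),$$ which is a diffeomorphism. (The formal statement also contains the existence of the manifold structures named above, and that the action is smooth, free and proper.) -/

import Mathlib

open scoped Quaternion Manifold ContDiff Matrix Topology

noncomputable section

namespace SliceMobius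

/-! ### The unit ball and the regular `*`-calculus -/

/-- The open unit ball of the quaternions. As an open subset of the real normed space `ℍ[ℝ]`
it is a smooth manifold modelled on `ℍ[ℝ]`. -/
def UnitBall : TopologicalSpace.Opens ℍ[ℝ] :=
  ⟨Metric.ball (0 : ℍ[ℝ]) 1, Metric.isOpen_ball⟩

/-- The origin of the unit ball. -/
def origin : UnitBall := ⟨0, by simp [UnitBall]⟩

/-- `f q = ∑ qⁿ aₙ` on the unit ball: `a` is a sequence of right power series coefficients
of `f`. -/
def HasExpansion (f : UnitBall → ℍ[ℝ]) (a : ℕ → ℍ[ℝ]) : Prop :=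
  ∀ q : UnitBall, HasSum (fun n => (q : ℍ[ℝ]) ^ n * a n) (f q)

open Classical in
/-- The (unique) sequence of right power series coefficients of `f`, if there is one. -/
def coeffs (f : UnitBall → ℍ[ℝ]) : ℕ → ℍ[ℝ] :=
  if h : ∃ a, HasExpansion f a then h.choose else 0

/-- The regular `*`-product: `(f * g)(q) = ∑ qⁿ cₙ` with `cₙ = ∑ aₖ bₙ₋ₖ`. -/
def starMul (f g : UnitBall → ℍ[ℝ]) : UnitBall → ℍ[ℝ] := fun q =>
  ∑' n, (q : ℍ[ℝ]) ^ n * ∑ ij ∈ Finset.HasAntidiagonal.antidiagonal n, coeffs f ij.1 * coeffs g ij.2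

/-- The regular conjugate: `fᶜ(q) = ∑ qⁿ āₙ`. -/
def regConj (f : UnitBall → ℍ[ℝ]) : UnitBall → ℍ[ℝ] := fun q =>
  ∑' n, (q : ℍ[ℝ]) ^ n * star (coeffs f n)

/-- The symmetrization: `fˢ = f * fᶜ`. -/
def symmetrization (f : UnitBall → ℍ[ℝ]) : UnitBall → ℍ[ℝ] := starMul f (regConj f)

/-- The regular reciprocal: `f⁻* = (1 / fˢ) fᶜ`. -/
def starInv (f : UnitBall → ℍ[ℝ]) : UnitBall → ℍ[ℝ] := fun q =>
  (symmetrization f q)⁻¹ * regConj f q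

/-- The affine map `l_{(a,b)}(q) = q a + b`. -/
def lin (a b : ℍ[ℝ]) : UnitBall → ℍ[ℝ] := fun q => (q : ℍ[ℝ]) * a + b

/-! ### The group `Sp(1,1)` -/

/-- The matrix `I_{1,1} = diag(1, -1)`. -/
def I11 : Matrix (Fin 2) (Fin 2) ℍ[ℝ] := !![1, 0; 0, -1]

theorem I11_mul_I11 : I11 * I11 = 1 := by
  ext i j : 1
  fin_cases i <;> fin_cases j <;> simp [I11]

theorem I11_star : I11ᴴ = I11 := by
  ext i j : 1
  fin_cases i <;> fin_cases j <;> simp [I11]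

/-- `Sp(1,1) = {A ∈ M₂(ℍ) : A* I_{1,1} A = I_{1,1}}`, a submonoid of `M₂(ℍ)` (a group, see below),
with the subspace topology. -/
def Sp11 : Submonoid (Matrix (Fin 2) (Fin 2) ℍ[ℝ]) where
  carrier := {A | Aᴴ * I11 * A = I11}
  one_mem' := by simp
  mul_mem' := by
    intro A B hA hB
    simp only [Set.mem_ofPred_eq] at hA hB ⊢
    calc (A * B)ᴴ * I11 * (A * B) = Bᴴ * (Aᴴ * I11 * A) * B := by
          simp only [Matrix.conjTranspose_mul, Matrix.mul_assoc]
      _ = I11 := by rw [hA, hB]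

theorem Sp11.left_inv {A : Matrix (Fin 2) (Fin 2) ℍ[ℝ]} (hA : A ∈ Sp11) :
    (I11 * Aᴴ * I11) * A = 1 := by
  have h : Aᴴ * I11 * A = I11 := hA
  rw [Matrix.mul_assoc, Matrix.mul_assoc, ← Matrix.mul_assoc Aᴴ, h, I11_mul_I11]

theorem Sp11.right_inv {A : Matrix (Fin 2) (Fin 2) ℍ[ℝ]} (hA : A ∈ Sp11) :
    A * (I11 * Aᴴ * I11) = 1 :=
  mul_eq_one_comm.mp (Sp11.left_inv hA)

theorem Sp11.row_rel {A : Matrix (Fin 2) (Fin 2) ℍ[ℝ]} (hA : A ∈ Sp11) :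
    A * I11 * Aᴴ = I11 := by
  have h := Sp11.right_inv hA
  calc A * I11 * Aᴴ = A * (I11 * Aᴴ * I11) * I11 := by
        simp only [Matrix.mul_assoc, I11_mul_I11, Matrix.mul_one]
    _ = I11 := by rw [h, Matrix.one_mul]

instance : Inv Sp11 where
  inv A := ⟨I11 * (A : Matrix (Fin 2) (Fin 2) ℍ[ℝ])ᴴ * I11, by
    have h := Sp11.row_rel A.2
    change (I11 * (A : Matrix (Fin 2) (Fin 2) ℍ[ℝ])ᴴ * I11)ᴴ * I11 *
      (I11 * (A : Matrix (Fin 2) (Fin 2) ℍ[ℝ])ᴴ * I11) = I11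
    simp only [Matrix.conjTranspose_mul, Matrix.conjTranspose_conjTranspose, I11_star]
    calc I11 * ((A : Matrix (Fin 2) (Fin 2) ℍ[ℝ]) * I11) * I11 *
          (I11 * (A : Matrix (Fin 2) (Fin 2) ℍ[ℝ])ᴴ * I11)
        = I11 * ((A : Matrix (Fin 2) (Fin 2) ℍ[ℝ]) * I11) * (I11 * I11) *
          ((A : Matrix (Fin 2) (Fin 2) ℍ[ℝ])ᴴ * I11) := by simp only [Matrix.mul_assoc]
      _ = I11 * ((A : Matrix (Fin 2) (Fin 2) ℍ[ℝ]) * I11 *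
          (A : Matrix (Fin 2) (Fin 2) ℍ[ℝ])ᴴ) * I11 := by
            rw [I11_mul_I11]; simp only [Matrix.mul_assoc, Matrix.one_mul]
      _ = I11 := by rw [h, I11_mul_I11, Matrix.one_mul]⟩

instance : Group Sp11 :=
  Group.ofLeftAxioms (fun a b c => mul_assoc a b c) (fun a => one_mul a)
    (fun A => Subtype.ext (Sp11.left_inv A.2))

/-! ### Regular Möbius transformations -/

/-- For `A = (a c; b d)`, the function `l_{(c,d)}⁻* * l_{(a,b)}` on the unit ball, i.e.
`(qc + d)⁻* * (qa + b)`. -/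
def mobiusVal (A : Matrix (Fin 2) (Fin 2) ℍ[ℝ]) : UnitBall → ℍ[ℝ] :=
  starMul (starInv (lin (A 0 1) (A 1 1))) (lin (A 0 0) (A 1 0))

theorem HasExpansion.unique {f : UnitBall → ℍ[ℝ]} {a b : ℕ → ℍ[ℝ]}
    (ha : HasExpansion f a) (hb : HasExpansion f b) : a = b := by
  let P : (ℕ → ℍ[ℝ]) → FormalMultilinearSeries ℝ ℝ ℍ[ℝ] :=
    fun c n => ContinuousMultilinearMap.mkPiRing ℝ (Fin n) (c n)
  have key : ∀ c : ℕ → ℍ[ℝ], HasExpansion f c →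
      HasFPowerSeriesAt (fun t : ℝ => ∑' n, (t : ℍ[ℝ]) ^ n * a n) (P c) 0 := by
    intro c hc
    refine hasFPowerSeriesAt_iff.mpr ?_
    filter_upwards [Metric.ball_mem_nhds (0 : ℝ) one_pos] with t ht
    have ht' : ((t : ℝ) : ℍ[ℝ]) ∈ UnitBall := by
      change ((t : ℝ) : ℍ[ℝ]) ∈ Metric.ball (0 : ℍ[ℝ]) 1
      simpa using ht
    have h1 := (ha ⟨_, ht'⟩).tsum_eq
    have h2 := hc ⟨_, ht'⟩
    simp only [zero_add]
    rw [← h1] at h2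
    have e : (fun n => t ^ n • (P c).coeff n) = fun n => ((t : ℝ) : ℍ[ℝ]) ^ n * c n := by
      funext n
      rw [← Quaternion.coe_pow, Quaternion.coe_mul_eq_smul]
      simp [FormalMultilinearSeries.coeff, P]
    rw [e]
    exact h2
  have h := (key a ha).eq_formalMultilinearSeries (key b hb)
  funext n
  have hn := congrFun h n
  have := congrArg (fun m => m (fun _ => (1 : ℝ))) hn
  simpa [P] using this

theorem coeffs_eq {f : UnitBall → ℍ[ℝ]} {a : ℕ → ℍ[ℝ]} (ha : HasExpansion f a) :
    coeffs f = a := by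
  have h : ∃ a, HasExpansion f a := ⟨a, ha⟩
  rw [coeffs, dif_pos h]
  exact h.choose_spec.unique ha

/-- The coefficients of `q a + b`. -/
def linCoeffs (a b : ℍ[ℝ]) : ℕ → ℍ[ℝ]
  | 0 => b
  | 1 => a
  | _ + 2 => 0

theorem lin_hasExpansion (a b : ℍ[ℝ]) : HasExpansion (lin a b) (linCoeffs a b) := by
  intro q
  have h : HasSum (fun n => (q : ℍ[ℝ]) ^ n * linCoeffs a b n)
      (∑ n ∈ Finset.range 2, (q : ℍ[ℝ]) ^ n * linCoeffs a b n) :=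
    hasSum_sum_of_ne_finset_zero (by
      intro n hn
      match n, hn with
      | 0, h => simp at h
      | 1, h => simp at h
      | n + 2, _ => simp [linCoeffs])
  simpa [Finset.sum_range_succ, linCoeffs, lin, add_comm] using h

theorem regConj_lin (c d : ℍ[ℝ]) : regConj (lin c d) = lin (star c) (star d) := by
  funext q
  rw [regConj, coeffs_eq (lin_hasExpansion c d)]
  have : ∀ n, star (linCoeffs c d n) = linCoeffs (star c) (star d) n := by
    intro n
    match n with
    | 0 => rfl
    | 1 => rfl
    | n + 2 => simp [linCoeffs]
  simp only [this]
  exact (lin_hasExpansion (star c) (star d) q).tsum_eq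

theorem starMul_lin {f : UnitBall → ℍ[ℝ]} {e : ℕ → ℍ[ℝ]} (he : HasExpansion f e)
    (a b : ℍ[ℝ]) (q : UnitBall) :
    starMul f (lin a b) q = f q * b + (q : ℍ[ℝ]) * f q * a := by
  rw [starMul, coeffs_eq he, coeffs_eq (lin_hasExpansion a b)]
  apply HasSum.tsum_eq
  have h1 : HasSum (fun n => (q : ℍ[ℝ]) ^ n * e n * b) (f q * b) := (he q).mul_right b
  have h2 : HasSum (fun n => if n = 0 then (0 : ℍ[ℝ]) else
      (q : ℍ[ℝ]) * ((q : ℍ[ℝ]) ^ (n - 1) * e (n - 1)) * a) ((q : ℍ[ℝ]) * f q * a) := by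
    rw [← hasSum_nat_add_iff' 1]
    simpa using ((he q).mul_left (q : ℍ[ℝ])).mul_right a
  convert h1.add h2 using 2 with n
  rw [Finset.Nat.sum_antidiagonal_eq_sum_range_succ (fun i j => e i * linCoeffs a b j)]
  match n with
  | 0 => simp [linCoeffs]
  | n + 1 =>
    rw [Finset.sum_range_succ, Finset.sum_range_succ, Finset.sum_eq_zero]
    · have h3 : n + 1 - n = 1 := by omega
      simp only [h3, Nat.sub_self, linCoeffs, zero_add, mul_add, Nat.add_eq_zero_iff, one_ne_zero,
        and_false, if_false, Nat.add_sub_cancel, pow_succ']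
      simp only [mul_assoc]
      abel
    · intro k hk
      obtain ⟨m, hm⟩ : ∃ m, n + 1 - k = m + 2 :=
        ⟨n - 1 - k, by have := Finset.mem_range.mp hk; omega⟩
      rw [hm]; simp [linCoeffs]

theorem UnitBall.norm_lt (q : UnitBall) : ‖(q : ℍ[ℝ])‖ < 1 := by
  have h : (q : ℍ[ℝ]) ∈ Metric.ball (0 : ℍ[ℝ]) 1 := q.2
  simpa using h

/-- If `|c| < |d|`, the regular reciprocal of `q c + d` is given by a power series and its value
`S` at `q` solves `S d + q S c = 1`. -/
theorem starInv_lin {c d : ℍ[ℝ]} (hcd : ‖c‖ < ‖d‖) :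
    (∃ e, HasExpansion (starInv (lin c d)) e) ∧
      ∀ q : UnitBall, starInv (lin c d) q * d + (q : ℍ[ℝ]) * starInv (lin c d) q * c = 1 := by
  have hd : d ≠ 0 := by
    rintro rfl
    simp at hcd
    exact absurd hcd (not_lt.mpr (norm_nonneg c))
  have hd' : 0 < ‖d‖ := norm_pos_iff.mpr hd
  set x : ℍ[ℝ] := -(d⁻¹ * c) with hx
  have hxn : ‖x‖ < 1 := by
    rw [hx, norm_neg, norm_mul, norm_inv, inv_mul_lt_iff₀ hd']
    simpa using hcd
  have hsum : ∀ q : UnitBall, Summable (fun n => (q : ℍ[ℝ]) ^ n * x ^ n) := by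
    intro q
    have hq := UnitBall.norm_lt q
    refine Summable.of_norm_bounded (g := fun n => ‖x‖ ^ n)
      (summable_geometric_of_lt_one (norm_nonneg _) hxn) (fun n => ?_)
    rw [norm_mul, norm_pow, norm_pow]
    calc ‖(q : ℍ[ℝ])‖ ^ n * ‖x‖ ^ n ≤ 1 * ‖x‖ ^ n := by
          gcongr
          exact pow_le_one₀ (norm_nonneg _) hq.le
      _ = ‖x‖ ^ n := one_mul _
  set W : UnitBall → ℍ[ℝ] := fun q => ∑' n, (q : ℍ[ℝ]) ^ n * x ^ n with hW
  have hWs : ∀ q : UnitBall, HasSum (fun n => (q : ℍ[ℝ]) ^ n * x ^ n) (W q) :=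
    fun q => (hsum q).hasSum
  have hWeq : ∀ q : UnitBall, W q = 1 + (q : ℍ[ℝ]) * W q * x := by
    intro q
    have h1 : W q = (q : ℍ[ℝ]) ^ 0 * x ^ 0 + ∑' n, (q : ℍ[ℝ]) ^ (n + 1) * x ^ (n + 1) :=
      (hsum q).tsum_eq_zero_add
    have h2 : HasSum (fun n => (q : ℍ[ℝ]) ^ (n + 1) * x ^ (n + 1)) ((q : ℍ[ℝ]) * W q * x) := by
      have e : (fun n => (q : ℍ[ℝ]) ^ (n + 1) * x ^ (n + 1)) =
          fun n => (q : ℍ[ℝ]) * ((q : ℍ[ℝ]) ^ n * x ^ n) * x := by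
        funext n
        rw [pow_succ', pow_succ]; simp only [mul_assoc]
      rw [e]
      exact ((hWs q).mul_left (q : ℍ[ℝ])).mul_right x
    rw [h2.tsum_eq] at h1
    simpa using h1
  have hS : ∀ q : UnitBall, (W q * d⁻¹) * d + (q : ℍ[ℝ]) * (W q * d⁻¹) * c = 1 := by
    intro q
    have h := hWeq q
    rw [inv_mul_cancel_right₀ hd]
    have h2 : (q : ℍ[ℝ]) * (W q * d⁻¹) * c = -((q : ℍ[ℝ]) * W q * x) := by
      rw [hx]; simp only [mul_neg, neg_neg, mul_assoc]
    rw [h2]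
    nth_rewrite 1 [h]
    abel
  have hval : ∀ q : UnitBall, starInv (lin c d) q = W q * d⁻¹ := by
    intro q
    set S := W q * d⁻¹ with hSdef
    have hs := hS q
    rw [← hSdef] at hs
    have hsym : symmetrization (lin c d) q =
        ((q : ℍ[ℝ]) * c + d) * star d + (q : ℍ[ℝ]) * ((q : ℍ[ℝ]) * c + d) * star c := by
      rw [symmetrization, regConj_lin, starMul_lin (lin_hasExpansion c d)]
      rfl
    have hmul : symmetrization (lin c d) q * S = (q : ℍ[ℝ]) * star c + star d := by
      have hr : c * star d + d * star c = ((2 * (c * star d).re : ℝ) : ℍ[ℝ]) := by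
        rw [← Quaternion.self_add_star']
        simp
      have e1 : symmetrization (lin c d) q = ((Quaternion.normSq d : ℝ) : ℍ[ℝ]) +
          (q : ℍ[ℝ]) * ((2 * (c * star d).re : ℝ) : ℍ[ℝ]) +
          (q : ℍ[ℝ]) * (q : ℍ[ℝ]) * ((Quaternion.normSq c : ℝ) : ℍ[ℝ]) := by
        rw [hsym, ← hr, ← Quaternion.self_mul_star, ← Quaternion.self_mul_star]
        noncomm_ring
      have e2 : (q : ℍ[ℝ]) * star c + star d =
          S * ((Quaternion.normSq d : ℝ) : ℍ[ℝ]) +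
          (q : ℍ[ℝ]) * (S * ((2 * (c * star d).re : ℝ) : ℍ[ℝ])) +
          (q : ℍ[ℝ]) * (q : ℍ[ℝ]) * (S * ((Quaternion.normSq c : ℝ) : ℍ[ℝ])) := by
        rw [← hr, ← Quaternion.self_mul_star, ← Quaternion.self_mul_star]
        calc (q : ℍ[ℝ]) * star c + star d
            = (q : ℍ[ℝ]) * (S * d + (q : ℍ[ℝ]) * S * c) * star c
              + (S * d + (q : ℍ[ℝ]) * S * c) * star d := by rw [hs]; simp
          _ = _ := by noncomm_ring
      rw [e1, e2, ← Quaternion.coe_commutes _ S, ← Quaternion.coe_commutes _ S,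
        ← Quaternion.coe_commutes _ S]
      noncomm_ring
    have hne : symmetrization (lin c d) q ≠ 0 := by
      intro h0
      rw [h0, zero_mul] at hmul
      have h1 : star d = -((q : ℍ[ℝ]) * star c) := by
        rw [eq_neg_iff_add_eq_zero, add_comm]; exact hmul.symm
      have h2 := congrArg norm h1
      rw [norm_neg, norm_mul, norm_star, norm_star] at h2
      have h3 : ‖(q : ℍ[ℝ])‖ * ‖c‖ ≤ 1 * ‖c‖ := by
        gcongr
        exact (UnitBall.norm_lt q).le
      linarith
    rw [starInv, regConj_lin]
    change _ * ((q : ℍ[ℝ]) * star c + star d) = _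
    rw [← hmul, inv_mul_cancel_left₀ hne]
  refine ⟨⟨fun n => x ^ n * d⁻¹, fun q => ?_⟩, fun q => ?_⟩
  · rw [hval]
    have e : (fun n => (q : ℍ[ℝ]) ^ n * (x ^ n * d⁻¹)) =
        fun n => (q : ℍ[ℝ]) ^ n * x ^ n * d⁻¹ := by
      funext n
      rw [mul_assoc]
    rw [e]
    exact (hWs q).mul_right d⁻¹
  · rw [hval]; exact hS q

section
variable {A : Matrix (Fin 2) (Fin 2) ℍ[ℝ]}

open Quaternion in
theorem Sp11.col00 (hA : A ∈ Sp11) : normSq (A 0 0) - normSq (A 1 0) = 1 := by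
  have h : Aᴴ * I11 * A = I11 := hA
  have h0 := congrFun (congrFun h 0) 0
  simp [Matrix.mul_apply, Fin.sum_univ_two, I11, star_mul_self] at h0
  have := congrArg (fun z : ℍ[ℝ] => z.re) h0
  simp at this
  linarith

open Quaternion in
theorem Sp11.col11 (hA : A ∈ Sp11) : normSq (A 1 1) - normSq (A 0 1) = 1 := by
  have h : Aᴴ * I11 * A = I11 := hA
  have h0 := congrFun (congrFun h 1) 1
  simp [Matrix.mul_apply, Fin.sum_univ_two, I11, star_mul_self] at h0
  have := congrArg (fun z : ℍ[ℝ] => z.re) h0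
  simp at this
  linarith

theorem Sp11.col01 (hA : A ∈ Sp11) : star (A 0 0) * A 0 1 = star (A 1 0) * A 1 1 := by
  have h : Aᴴ * I11 * A = I11 := hA
  have h0 := congrFun (congrFun h 0) 1
  simp [Matrix.mul_apply, Fin.sum_univ_two, I11] at h0
  exact add_neg_eq_zero.mp h0

open Quaternion in
theorem Sp11.row00 (hA : A ∈ Sp11) : normSq (A 0 0) - normSq (A 0 1) = 1 := by
  have h := Sp11.row_rel hA
  have h0 := congrFun (congrFun h 0) 0
  simp [Matrix.mul_apply, Fin.sum_univ_two, I11, self_mul_star] at h0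
  have := congrArg (fun z : ℍ[ℝ] => z.re) h0
  simp at this
  linarith

theorem Sp11.row01 (hA : A ∈ Sp11) : A 0 0 * star (A 1 0) = A 0 1 * star (A 1 1) := by
  have h := Sp11.row_rel hA
  have h0 := congrFun (congrFun h 0) 1
  simp [Matrix.mul_apply, Fin.sum_univ_two, I11] at h0
  exact add_neg_eq_zero.mp h0

theorem norm_lt_of_normSq_lt {x y : ℍ[ℝ]} (h : Quaternion.normSq x < Quaternion.normSq y) :
    ‖x‖ < ‖y‖ := by
  rw [Quaternion.normSq_eq_norm_mul_self, Quaternion.normSq_eq_norm_mul_self] at h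
  exact lt_of_mul_self_lt_mul_self₀ (norm_nonneg _) h

theorem normSq_lt_one {x : ℍ[ℝ]} (h : ‖x‖ < 1) : Quaternion.normSq x < 1 := by
  rw [Quaternion.normSq_eq_norm_mul_self]
  nlinarith [norm_nonneg x]

theorem Sp11.norm_c_lt_d (hA : A ∈ Sp11) : ‖A 0 1‖ < ‖A 1 1‖ :=
  norm_lt_of_normSq_lt (by linarith [Sp11.col11 hA])

theorem Sp11.norm_c_lt_a (hA : A ∈ Sp11) : ‖A 0 1‖ < ‖A 0 0‖ :=
  norm_lt_of_normSq_lt (by linarith [Sp11.row00 hA])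

theorem Sp11.exists_S (hA : A ∈ Sp11) (q : UnitBall) :
    ∃ S : ℍ[ℝ], S * A 1 1 + (q : ℍ[ℝ]) * S * A 0 1 = 1 ∧
      mobiusVal A q = S * A 1 0 + (q : ℍ[ℝ]) * S * A 0 0 := by
  obtain ⟨⟨e, he⟩, h⟩ := starInv_lin (Sp11.norm_c_lt_d hA)
  exact ⟨_, h q, starMul_lin he _ _ q⟩

theorem unique_S {c d S T : ℍ[ℝ]} (hcd : ‖c‖ < ‖d‖) (q : UnitBall)
    (hS : S * d + (q : ℍ[ℝ]) * S * c = 1) (hT : T * d + (q : ℍ[ℝ]) * T * c = 1) : S = T := by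
  by_contra hne
  have h0 : 0 < ‖S - T‖ := norm_pos_iff.mpr (sub_ne_zero.mpr hne)
  have h : (S - T) * d = -((q : ℍ[ℝ]) * (S - T) * c) := by
    rw [eq_neg_iff_add_eq_zero]
    calc (S - T) * d + (q : ℍ[ℝ]) * (S - T) * c
        = (S * d + (q : ℍ[ℝ]) * S * c) - (T * d + (q : ℍ[ℝ]) * T * c) := by noncomm_ring
      _ = 0 := by rw [hS, hT, sub_self]
  have h1 := congrArg norm h
  rw [norm_neg, norm_mul, norm_mul, norm_mul] at h1
  have h2 := UnitBall.norm_lt q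
  have h3 : ‖(q : ℍ[ℝ])‖ * ‖S - T‖ * ‖c‖ ≤ 1 * ‖S - T‖ * ‖c‖ := by gcongr
  have h4 : ‖S - T‖ * ‖c‖ < ‖S - T‖ * ‖d‖ := by gcongr
  linarith

theorem Sp11.mobiusVal_eq (hA : A ∈ Sp11) (q : UnitBall) {S : ℍ[ℝ]}
    (hS : S * A 1 1 + (q : ℍ[ℝ]) * S * A 0 1 = 1) :
    mobiusVal A q = S * A 1 0 + (q : ℍ[ℝ]) * S * A 0 0 := by
  obtain ⟨T, hT, h⟩ := Sp11.exists_S hA q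
  rw [unique_S (Sp11.norm_c_lt_d hA) q hS hT, h]

/-- Relation with the classical Möbius transformation, at the conjugate point
`p = S⁻¹ q S`. -/
theorem Sp11.exists_p (hA : A ∈ Sp11) (q : UnitBall) :
    ∃ p S : ℍ[ℝ], ‖p‖ < 1 ∧ S ≠ 0 ∧ p = S⁻¹ * (q : ℍ[ℝ]) * S ∧
      S * (p * A 0 1 + A 1 1) = 1 ∧ mobiusVal A q = S * (p * A 0 0 + A 1 0) := by
  obtain ⟨S, hS, h⟩ := Sp11.exists_S hA q
  have hS0 : S ≠ 0 := by
    rintro rfl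
    simp at hS
  refine ⟨S⁻¹ * (q : ℍ[ℝ]) * S, S, ?_, hS0, rfl, ?_, ?_⟩
  · rw [norm_mul, norm_mul, norm_inv, mul_right_comm,
      inv_mul_cancel₀ (norm_ne_zero_iff.mpr hS0), one_mul]
    exact UnitBall.norm_lt q
  · rw [mul_add, ← mul_assoc, mul_assoc S⁻¹, mul_inv_cancel_left₀ hS0, add_comm]
    exact hS
  · rw [h, mul_add, ← mul_assoc S (S⁻¹ * _ * S), mul_assoc S⁻¹, mul_inv_cancel_left₀ hS0, add_comm]

theorem Sp11.num_lt_den (hA : A ∈ Sp11) {p : ℍ[ℝ]} (hp : ‖p‖ < 1) :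
    ‖p * A 0 0 + A 1 0‖ < ‖p * A 0 1 + A 1 1‖ := by
  apply norm_lt_of_normSq_lt
  have h := normSq_lt_one hp
  rw [Quaternion.normSq_add, Quaternion.normSq_add, mul_assoc, mul_assoc, Sp11.row01 hA,
    map_mul, map_mul]
  have h0 := Sp11.row00 hA
  have h1 := Sp11.col00 hA
  have h2 := Sp11.col11 hA
  nlinarith

theorem Sp11.mobiusVal_mem (hA : A ∈ Sp11) (q : UnitBall) : mobiusVal A q ∈ UnitBall := by
  change mobiusVal A q ∈ Metric.ball (0 : ℍ[ℝ]) 1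
  obtain ⟨p, S, hp, hS0, -, h1, h2⟩ := Sp11.exists_p hA q
  have h3 := congrArg norm h1
  rw [norm_mul, norm_one] at h3
  have h4 := Sp11.num_lt_den hA hp
  have h5 : 0 < ‖S‖ := norm_pos_iff.mpr hS0
  rw [mem_ball_zero_iff, h2, norm_mul, ← h3]
  gcongr

end

/-- The regular Möbius transformation `𝓕_A : 𝔹 → 𝔹` of `A ∈ Sp(1,1)`. -/
def regMobius (A : Sp11) : UnitBall → UnitBall := fun q =>
  ⟨mobiusVal A q, Sp11.mobiusVal_mem A.2 q⟩

theorem regMobius_injective (A : Sp11) : Function.Injective (regMobius A) := by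
  intro q₁ q₂ h
  have hv : mobiusVal A q₁ = mobiusVal A q₂ := congrArg Subtype.val h
  obtain ⟨p₁, S₁, hp₁, hS₁, e₁, f₁, g₁⟩ := Sp11.exists_p A.2 q₁
  obtain ⟨p₂, S₂, hp₂, hS₂, e₂, f₂, g₂⟩ := Sp11.exists_p A.2 q₂
  set a := (A : Matrix (Fin 2) (Fin 2) ℍ[ℝ]) 0 0
  set b := (A : Matrix (Fin 2) (Fin 2) ℍ[ℝ]) 1 0
  set c := (A : Matrix (Fin 2) (Fin 2) ℍ[ℝ]) 0 1 with hc
  set d := (A : Matrix (Fin 2) (Fin 2) ℍ[ℝ]) 1 1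
  set w := mobiusVal A q₁ with hw
  have hw1 : ‖w‖ < 1 := by
    have := UnitBall.norm_lt (regMobius A q₁)
    exact this
  have k₁ : p₁ * (c * w - a) = b - d * w := by
    have : (p₁ * c + d) * w = p₁ * a + b := by
      rw [g₁, ← mul_assoc, mul_eq_one_comm.mp f₁, one_mul]
    rw [mul_sub, ← mul_assoc, sub_eq_sub_iff_add_eq_add, ← add_mul, this, add_comm]
  have k₂ : p₂ * (c * w - a) = b - d * w := by
    have : (p₂ * c + d) * w = p₂ * a + b := by
      rw [hv, g₂, ← mul_assoc, mul_eq_one_comm.mp f₂, one_mul]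
    rw [mul_sub, ← mul_assoc, sub_eq_sub_iff_add_eq_add, ← add_mul, this, add_comm]
  have hne : c * w - a ≠ 0 := by
    intro h0
    have h1 := congrArg norm (sub_eq_zero.mp h0)
    rw [norm_mul] at h1
    have h2 : ‖c‖ * ‖w‖ ≤ ‖c‖ * 1 := by gcongr
    have h3 := Sp11.norm_c_lt_a A.2
    change ‖c‖ < ‖a‖ at h3
    linarith
  have hp : p₁ = p₂ := mul_right_cancel₀ hne (k₁.trans k₂.symm)
  have hS : S₁ = S₂ := by
    rw [← hp] at f₂
    rw [eq_inv_of_mul_eq_one_left f₁, eq_inv_of_mul_eq_one_left f₂]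
  have hq : ∀ {p S q : ℍ[ℝ]}, S ≠ 0 → p = S⁻¹ * q * S → q = S * p * S⁻¹ := by
    intro p S q hS h
    rw [h, mul_assoc S⁻¹, mul_inv_cancel_left₀ hS, mul_inv_cancel_right₀ hS]
  apply Subtype.ext
  rw [hq hS₁ e₁, hq hS₂ e₂, hp, hS]

theorem regMobius_surjective (A : Sp11) : Function.Surjective (regMobius A) := by
  intro w
  have hw := UnitBall.norm_lt w
  have hA := A.2
  set a := (A : Matrix (Fin 2) (Fin 2) ℍ[ℝ]) 0 0 with ha
  set b := (A : Matrix (Fin 2) (Fin 2) ℍ[ℝ]) 1 0 with hb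
  set c := (A : Matrix (Fin 2) (Fin 2) ℍ[ℝ]) 0 1 with hc
  set d := (A : Matrix (Fin 2) (Fin 2) ℍ[ℝ]) 1 1 with hd
  have hlt : ‖b - d * (w : ℍ[ℝ])‖ < ‖c * (w : ℍ[ℝ]) - a‖ := by
    rw [norm_sub_rev (c * _) a, ← norm_star, ← norm_star (a - _)]
    apply norm_lt_of_normSq_lt
    have h := normSq_lt_one hw
    have h0 : Quaternion.normSq a - Quaternion.normSq c = 1 := Sp11.row00 hA
    have h1 : Quaternion.normSq a - Quaternion.normSq b = 1 := Sp11.col00 hA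
    have h2 : Quaternion.normSq d - Quaternion.normSq c = 1 := Sp11.col11 hA
    have h3 : star a * c = star b * d := Sp11.col01 hA
    rw [sub_eq_add_neg, sub_eq_add_neg, star_add, star_add, Quaternion.normSq_add,
      Quaternion.normSq_add, star_star, star_star, mul_neg, mul_neg, ← mul_assoc, ← mul_assoc, h3]
    simp only [Quaternion.normSq_star, Quaternion.normSq_neg, map_mul]
    nlinarith
  have hne : c * (w : ℍ[ℝ]) - a ≠ 0 := norm_pos_iff.mp (lt_of_le_of_lt (norm_nonneg _) hlt)
  obtain ⟨p, hp⟩ : ∃ p, p = (b - d * (w : ℍ[ℝ])) * (c * (w : ℍ[ℝ]) - a)⁻¹ := ⟨_, rfl⟩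
  have hp1 : ‖p‖ < 1 := by
    rw [hp, norm_mul, norm_inv, ← div_eq_mul_inv, div_lt_one (norm_pos_iff.mpr hne)]
    exact hlt
  have hk : p * (c * (w : ℍ[ℝ]) - a) = b - d * (w : ℍ[ℝ]) := by
    rw [hp, inv_mul_cancel_right₀ hne]
  have hk2 : (p * c + d) * (w : ℍ[ℝ]) = p * a + b := by
    rw [mul_sub, ← mul_assoc, sub_eq_sub_iff_add_eq_add] at hk
    rw [add_mul, hk, add_comm]
  have hden : p * c + d ≠ 0 :=
    norm_pos_iff.mp (lt_of_le_of_lt (norm_nonneg _) (Sp11.num_lt_den hA hp1))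
  have hqm : (p * c + d)⁻¹ * p * (p * c + d) ∈ UnitBall := by
    change _ ∈ Metric.ball (0 : ℍ[ℝ]) 1
    rw [mem_ball_zero_iff, norm_mul, norm_mul, norm_inv, mul_right_comm,
      inv_mul_cancel₀ (norm_ne_zero_iff.mpr hden), one_mul]
    exact hp1
  refine ⟨⟨_, hqm⟩, Subtype.ext ?_⟩
  have e : (p * c + d)⁻¹ * p * (p * c + d) * (p * c + d)⁻¹ = (p * c + d)⁻¹ * p :=
    mul_inv_cancel_right₀ hden _
  have h := Sp11.mobiusVal_eq hA ⟨_, hqm⟩ (S := (p * c + d)⁻¹) (by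
    change _ * d + (p * c + d)⁻¹ * p * (p * c + d) * (p * c + d)⁻¹ * c = 1
    rw [e, mul_assoc, ← mul_add, add_comm d, inv_mul_cancel₀ hden])
  change mobiusVal A _ = _
  rw [h]
  change _ * b + (p * c + d)⁻¹ * p * (p * c + d) * (p * c + d)⁻¹ * a = _
  rw [e, mul_assoc, ← mul_add, add_comm b, ← hk2, inv_mul_cancel_left₀ hden]

theorem regMobius_bijective (A : Sp11) : Function.Bijective (regMobius A) :=
  ⟨regMobius_injective A, regMobius_surjective A⟩

/-- The set `𝓜(𝔹) = {𝓕_A : A ∈ Sp(1,1)}` of all regular Möbius transformations of the unit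
ball. -/
def RegularMobius : Type := Set.range regMobius

instance : CoeFun RegularMobius (fun _ => UnitBall → UnitBall) := ⟨fun F => F.1⟩

theorem RegularMobius.ext {F G : RegularMobius} (h : ∀ q, F q = G q) : F = G :=
  Subtype.ext (funext h)

theorem RegularMobius.bijective (F : RegularMobius) : Function.Bijective F := by
  obtain ⟨A, hA⟩ := F.2
  rw [← hA]
  exact regMobius_bijective A

/-- The map `Sp(1,1) → 𝓜(𝔹)`, `A ↦ 𝓕_{A⁻¹}`. -/
def toRegularMobius (A : Sp11) : RegularMobius := ⟨regMobius A⁻¹, A⁻¹, rfl⟩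

/-- The topology of `𝓜(𝔹)`: the quotient topology for `A ↦ 𝓕_{A⁻¹}`. -/
instance : TopologicalSpace RegularMobius :=
  TopologicalSpace.coinduced toRegularMobius inferInstance

/-- The inverse orbit map at the origin, `𝓕 ↦ 𝓕⁻¹(0)`. -/
def inverseOrbit (F : RegularMobius) : UnitBall :=
  (Equiv.ofBijective F F.bijective).symm origin

/-! ### The isotropy group at the origin and its action -/

/-- The isotropy `𝓜(𝔹)₀ = {𝓕 ∈ 𝓜(𝔹) : 𝓕(0) = 0}`. -/
def Isotropy : Type := {F : RegularMobius // F origin = origin}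

/-- The inclusion of the isotropy in `𝓜(𝔹)`. -/
def Isotropy.incl (g : Isotropy) : RegularMobius := g.1

/-- The isotropy has the subspace topology. -/
instance : TopologicalSpace Isotropy := TopologicalSpace.induced Isotropy.incl inferInstance

instance : CoeFun Isotropy (fun _ => UnitBall → UnitBall) := ⟨fun g => g.incl⟩

theorem Isotropy.ext {g h : Isotropy} (H : ∀ q, g q = h q) : g = h :=
  Subtype.ext (RegularMobius.ext H)

theorem Isotropy.map_origin (g : Isotropy) : g origin = origin := g.2

theorem diag_mul_mem (A : Sp11) {u : ℍ[ℝ]} (hu : Quaternion.normSq u = 1) :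
    (A : Matrix (Fin 2) (Fin 2) ℍ[ℝ]) * !![u, 0; 0, 1] ∈ Sp11 := by
  refine Sp11.mul_mem A.2 ?_
  change (!![u, 0; 0, 1] : Matrix (Fin 2) (Fin 2) ℍ[ℝ])ᴴ * I11 * !![u, 0; 0, 1] = I11
  ext i j : 1
  fin_cases i <;> fin_cases j <;>
    simp [Matrix.mul_apply, Fin.sum_univ_two, I11, Quaternion.star_mul_self, hu]

/-- Right multiplication of values by a unit quaternion preserves `𝓜(𝔹)`. -/
theorem exists_rotate (F : RegularMobius) {u : ℍ[ℝ]} (hu : Quaternion.normSq u = 1) :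
    ∃ G : RegularMobius, ∀ q, (G q : ℍ[ℝ]) = (F q : ℍ[ℝ]) * u := by
  obtain ⟨A, hA⟩ := F.2
  refine ⟨⟨_, ⟨⟨_, diag_mul_mem A hu⟩, rfl⟩⟩, fun q => ?_⟩
  obtain ⟨S, hS, h⟩ := Sp11.exists_S A.2 q
  have hF : (F q : ℍ[ℝ]) = mobiusVal A q := by
    rw [← hA]; rfl
  rw [hF, h]
  change mobiusVal _ q = _
  rw [Sp11.mobiusVal_eq (diag_mul_mem A hu) q (S := S)
    (by simpa [Matrix.mul_apply, Fin.sum_univ_two] using hS)]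
  simp [Matrix.mul_apply, Fin.sum_univ_two, add_mul, mul_assoc]

theorem exists_id : ∃ G : RegularMobius, ∀ q, G q = q := by
  refine ⟨⟨_, ⟨1, rfl⟩⟩, fun q => Subtype.ext ?_⟩
  change mobiusVal (1 : Matrix (Fin 2) (Fin 2) ℍ[ℝ]) q = _
  rw [Sp11.mobiusVal_eq (Sp11.one_mem) q (S := 1) (by simp)]
  simp

theorem Isotropy.exists_unit (g : Isotropy) :
    ∃ u : ℍ[ℝ], Quaternion.normSq u = 1 ∧ ∀ q, (g q : ℍ[ℝ]) = (q : ℍ[ℝ]) * u := by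
  obtain ⟨A, hA⟩ := g.1.2
  have hg : ∀ q, (g q : ℍ[ℝ]) = mobiusVal A q := by
    intro q
    change ((g.1.1 q : UnitBall) : ℍ[ℝ]) = _
    rw [← hA]; rfl
  have hmem := A.2
  set a := (A : Matrix (Fin 2) (Fin 2) ℍ[ℝ]) 0 0 with ha
  set b := (A : Matrix (Fin 2) (Fin 2) ℍ[ℝ]) 1 0 with hb
  set c := (A : Matrix (Fin 2) (Fin 2) ℍ[ℝ]) 0 1 with hc
  set d := (A : Matrix (Fin 2) (Fin 2) ℍ[ℝ]) 1 1 with hd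
  have h0 : Quaternion.normSq a - Quaternion.normSq c = 1 := Sp11.row00 hmem
  have h1 : Quaternion.normSq a - Quaternion.normSq b = 1 := Sp11.col00 hmem
  have h2 : Quaternion.normSq d - Quaternion.normSq c = 1 := Sp11.col11 hmem
  have hd0 : d ≠ 0 := by
    intro h
    rw [h, map_zero] at h2
    have := Quaternion.normSq_nonneg (a := c)
    linarith
  have hbz : b = 0 := by
    have h := Sp11.mobiusVal_eq hmem origin (S := d⁻¹)
      (by simp [origin, ← hd, inv_mul_cancel₀ hd0])
    rw [← hg, g.map_origin] at h
    simpa [origin, ← hb, hd0] using h.symm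
  have hcz : c = 0 := by
    rw [← Quaternion.normSq_eq_zero]
    rw [hbz, map_zero] at h1
    linarith
  rw [hbz, map_zero] at h1
  rw [hcz, map_zero] at h2
  refine ⟨d⁻¹ * a, ?_, fun q => ?_⟩
  · rw [map_mul, Quaternion.normSq_inv]
    have h3 : Quaternion.normSq a = 1 := by linarith
    have h4 : Quaternion.normSq d = 1 := by linarith
    rw [h3, h4]; simp
  · rw [hg, Sp11.mobiusVal_eq hmem q (S := d⁻¹)
      (by rw [← hc, ← hd, hcz, mul_zero, add_zero, inv_mul_cancel₀ hd0])]
    rw [← hb, hbz, mul_zero, zero_add, mul_assoc]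

theorem Isotropy.exists_comp (g : Isotropy) (F : RegularMobius) :
    ∃ G : RegularMobius, G.1 = g ∘ F := by
  obtain ⟨u, hu, h⟩ := g.exists_unit
  obtain ⟨G, hG⟩ := exists_rotate F hu
  exact ⟨G, funext fun q => Subtype.ext (by rw [hG]; exact (h _).symm)⟩

/-- The composition `𝓕₀ ∘ 𝓕` of `𝓕₀ ∈ 𝓜(𝔹)₀` and `𝓕 ∈ 𝓜(𝔹)`, as an element of `𝓜(𝔹)`. -/
instance : SMul Isotropy RegularMobius where
  smul g F := ⟨g ∘ F, by
    obtain ⟨G, hG⟩ := g.exists_comp F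
    rw [← hG]; exact G.2⟩

theorem Isotropy.smul_apply (g : Isotropy) (F : RegularMobius) (q : UnitBall) :
    (g • F) q = g (F q) := rfl

/-- The product of the isotropy group is the composition of maps. -/
instance : Mul Isotropy where
  mul g h := ⟨g • h.incl, by
    rw [Isotropy.smul_apply, h.map_origin, g.map_origin]⟩

theorem Isotropy.mul_apply (g h : Isotropy) (q : UnitBall) : (g * h) q = g (h q) := rfl

instance : One Isotropy where
  one := ⟨⟨id, by
    obtain ⟨G, hG⟩ := exists_id
    have : G.1 = id := funext hG
    rw [← this]; exact G.2⟩, rfl⟩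

theorem Isotropy.one_apply (q : UnitBall) : (1 : Isotropy) q = q := rfl

theorem Isotropy.exists_inv (g : Isotropy) : ∃ h : Isotropy, ∀ q, h (g q) = q := by
  obtain ⟨u, hu, h⟩ := g.exists_unit
  obtain ⟨G, hG⟩ := exists_rotate (1 : Isotropy).incl (u := u⁻¹)
    (by rw [Quaternion.normSq_inv, hu, inv_one])
  have hG' : ∀ q, (G q : ℍ[ℝ]) = (q : ℍ[ℝ]) * u⁻¹ := hG
  have hu0 : u ≠ 0 := by
    rintro rfl
    simp at hu
  refine ⟨⟨G, Subtype.ext (by rw [hG']; simp [origin])⟩, fun q => Subtype.ext ?_⟩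
  change ((G (g q) : UnitBall) : ℍ[ℝ]) = _
  rw [hG', h, mul_inv_cancel_right₀ hu0]

/-- The inverse in the isotropy group is the inverse map. -/
instance : Inv Isotropy where
  inv g := g.exists_inv.choose

instance : Group Isotropy :=
  Group.ofLeftAxioms (fun _ _ _ => rfl) (fun _ => rfl)
    (fun g => Isotropy.ext g.exists_inv.choose_spec)

instance : MulAction Isotropy RegularMobius where
  one_smul _ := rfl
  mul_smul _ _ _ := rfl

/-- The quotient `𝓜(𝔹)₀ \ 𝓜(𝔹)`, i.e. the space of orbits `𝓜(𝔹)₀ 𝓕`, with the quotient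
topology. -/
abbrev OrbitSpace : Type := Quotient (MulAction.orbitRel Isotropy RegularMobius)

/-- The projection `𝓕 ↦ 𝓜(𝔹)₀ 𝓕`. -/
def orbitProj (F : RegularMobius) : OrbitSpace := Quotient.mk _ F

/-! ### Submersions and embedded submanifolds -/

/-- The inclusion of `Sp(1,1)` in the real vector space of `2 × 2` quaternionic matrices. -/
def Sp11.incl (A : Sp11) : Fin 2 → Fin 2 → ℍ[ℝ] :=
  fun i j => (A : Matrix (Fin 2) (Fin 2) ℍ[ℝ]) i j

section
variable (E F : Type*) [NormedAddCommGroup E] [NormedSpace ℝ E]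
  [NormedAddCommGroup F] [NormedSpace ℝ F]
  {M N : Type*} [TopologicalSpace M] [ChartedSpace E M] [TopologicalSpace N] [ChartedSpace F N]

/-- A submersion: a surjective smooth map with surjective differential at every point. -/
structure IsSmoothSubmersion (f : M → N) : Prop where
  contMDiff : ContMDiff 𝓘(ℝ, E) 𝓘(ℝ, F) ∞ f
  surjective : Function.Surjective f
  mfderiv_surjective : ∀ x, Function.Surjective (mfderiv 𝓘(ℝ, E) 𝓘(ℝ, F) f x)

/-- A smooth embedding: a smooth map with injective differential at every point, that is a
homeomorphism onto its image. For the inclusion of a subset this says that the subset is an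
embedded submanifold. -/
structure IsEmbeddingOfManifolds (f : M → N) : Prop where
  contMDiff : ContMDiff 𝓘(ℝ, E) 𝓘(ℝ, F) ∞ f
  isEmbedding : Topology.IsEmbedding f
  mfderiv_injective : ∀ x, Function.Injective (mfderiv 𝓘(ℝ, E) 𝓘(ℝ, F) f x)

end

/-- The model space of `n`-dimensional manifolds. -/
abbrev Model (n : ℕ) : Type := EuclideanSpace ℝ (Fin n)

end SliceMobius

end

open SliceMobius

/-!
For `A = (a c; b d) ∈ Sp(1,1)` put `v = d / |d|`, `u = a d⁻¹` and `p = b d⁻¹`. The relations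
defining `Sp(1,1)` say that `u` and `v` are unit quaternions and `|p| < 1`, and they recover `A` as
`(1 - |p|²)^(-1/2) diag(u, 1) (1 p*; p 1) v`, so `A ↦ (v, u, p)` identifies `Sp(1,1)` with
`Sp(1) × Sp(1) × 𝔹`. As `𝓕_{A⁻¹} = (1 - q p*)^{-*} * (q - p) u*` vanishes exactly at `p` and
determines `u`, the projection `A ↦ 𝓕_{A⁻¹}` becomes `(v, u, p) ↦ (u, p)`, and `𝓕 ↦ 𝓕⁻¹(0)`
becomes `(u, p) ↦ p`. The isotropy consists of the maps `q ↦ q u*` and acts by left multiplication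
on the factor `u`, so its orbits are exactly the fibres of `(u, p) ↦ p`.

These identifications are diffeomorphisms for all manifold structures allowed: a map into the source
of an embedding is smooth once its composite with the embedding is, because an embedding has smooth
local left inverses, and a map out of the target of a submersion is smooth once its composite with
the submersion is, because a submersion has smooth local sections.
-/

noncomputable section

namespace SliceMobius

/-! ### Immersions and submersions -/

section
variable {𝕜 : Type*} [RCLike 𝕜] {n : ℕ∞ω}
  {E : Type*} [NormedAddCommGroup E] [NormedSpace 𝕜 E]
  {F : Type*} [NormedAddCommGroup F] [NormedSpace 𝕜 F]

section
variable {φ : E → F} {φ' : E →L[𝕜] F} {a : E}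

theorem exists_contDiffAt_localLeftInverse [CompleteSpace E] (hφ : ContDiffAt 𝕜 n φ a)
    (hφ' : HasFDerivAt φ φ' a) (hinv : φ'.HasLeftInverse) (hn : n ≠ 0) :
    ∃ ρ : F → E, ContDiffAt 𝕜 n ρ (φ a) ∧ ∀ᶠ v in 𝓝 a, ρ (φ v) = v := by
  obtain ⟨L, hL⟩ := hinv
  have hLφ : ContDiffAt 𝕜 n (L ∘ φ) a := L.contDiff.contDiffAt.comp a hφ
  have hLφ' : HasFDerivAt (L ∘ φ) (ContinuousLinearEquiv.refl 𝕜 E : E →L[𝕜] E) a :=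
    (L.hasFDerivAt.comp a hφ').congr_fderiv (ContinuousLinearMap.ext hL)
  exact ⟨hLφ.localInverse hLφ' hn ∘ L,
    (hLφ.to_localInverse hLφ' hn).comp (φ a) L.contDiff.contDiffAt,
    (hLφ.hasStrictFDerivAt' hLφ' hn).eventually_left_inverse⟩

theorem exists_contDiffAt_localSection [CompleteSpace F] (hφ : ContDiffAt 𝕜 n φ a)
    (hφ' : HasFDerivAt φ φ' a) (hinv : φ'.HasRightInverse) (hn : n ≠ 0) :
    ∃ σ : F → E, ContDiffAt 𝕜 n σ (φ a) ∧ σ (φ a) = a ∧ ∀ᶠ w in 𝓝 (φ a), φ (σ w) = w := by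
  obtain ⟨R, hR⟩ := hinv
  let r : F → E := fun w => a + R w
  have hr : ContDiff 𝕜 n r := contDiff_const.add R.contDiff
  have hr' : HasFDerivAt r R 0 := R.hasFDerivAt.const_add a
  have hr0 : r 0 = a := by simp [r]
  have hφr : ContDiffAt 𝕜 n (φ ∘ r) 0 := ContDiffAt.comp 0 (hr0.symm ▸ hφ) hr.contDiffAt
  have hφr' : HasFDerivAt (φ ∘ r) (ContinuousLinearEquiv.refl 𝕜 F : F →L[𝕜] F) 0 :=
    (HasFDerivAt.comp 0 (hr0.symm ▸ hφ') hr').congr_fderiv (ContinuousLinearMap.ext hR)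
  have hsmooth := hφr.to_localInverse hφr' hn
  have hbase := hφr.localInverse_apply_image hφr' hn
  have hright := (hφr.hasStrictFDerivAt' hφr' hn).eventually_right_inverse
  rw [Function.comp_apply, hr0] at hsmooth hbase hright
  exact ⟨r ∘ hφr.localInverse hφr' hn, hr.contDiffAt.comp (φ a) hsmooth,
    (congrArg r hbase).trans hr0, hright⟩

end

variable {H : Type*} [TopologicalSpace H] {I : ModelWithCorners 𝕜 E H} [I.Boundaryless]
  {K : Type*} [TopologicalSpace K] {J : ModelWithCorners 𝕜 F K}
  {M : Type*} [TopologicalSpace M] [ChartedSpace H M]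
  {N : Type*} [TopologicalSpace N] [ChartedSpace K N]
  {f : M → N} {x : M}

theorem contDiffAt_writtenInExtChartAt (hf : ContMDiffAt I J n f x) :
    ContDiffAt 𝕜 n (writtenInExtChartAt I J x f) (extChartAt I x x) := by
  have h := (contMDiffAt_iff.1 hf).2
  rwa [I.range_eq_univ, contDiffWithinAt_univ] at h

theorem hasFDerivAt_writtenInExtChartAt (hf : MDifferentiableAt I J f x) :
    HasFDerivAt (writtenInExtChartAt I J x f) (mfderiv I J f x : E →L[𝕜] F)
      (extChartAt I x x) :=
  hf.hasMFDerivAt.2.hasFDerivAt (by rw [I.range_eq_univ]; exact Filter.univ_mem)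

omit [I.Boundaryless] in
theorem writtenInExtChartAt_apply_extChartAt {y : M} (hy : y ∈ (extChartAt I x).source) :
    writtenInExtChartAt I J x f (extChartAt I x y) = extChartAt J (f x) (f y) :=
  congrArg (extChartAt J (f x) ∘ f) ((extChartAt I x).left_inv hy)

variable [IsManifold I n M]

theorem exists_contMDiffAt_localLeftInverse [CompleteSpace E] (hf : ContMDiffAt I J n f x)
    (hd : (mfderiv I J f x).HasLeftInverse) (hn : n ≠ 0) :
    ∃ g : N → M, ContMDiffAt J I n g (f x) ∧ ∀ᶠ y in 𝓝 x, g (f y) = y := by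
  obtain ⟨ρ, hρ, hρφ⟩ := exists_contDiffAt_localLeftInverse (contDiffAt_writtenInExtChartAt hf)
    (hasFDerivAt_writtenInExtChartAt (hf.mdifferentiableAt hn)) hd hn
  have hρx := hρφ.self_of_nhds
  rw [writtenInExtChartAt_apply_extChartAt (mem_extChartAt_source x)] at hρ hρx
  refine ⟨(extChartAt I x).symm ∘ ρ ∘ extChartAt J (f x), ?_, ?_⟩
  · have hsymm := (contMDiffOn_extChartAt_symm (I := I) (n := n) x).contMDiffAt
      (extChartAt_target_mem_nhds x)
    exact hsymm.comp_of_eq (hρ.contMDiffAt.comp (f x) contMDiffAt_extChartAt) hρx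
  · filter_upwards [extChartAt_source_mem_nhds (I := I) x,
      (continuousAt_extChartAt x).eventually hρφ] with y hy hρy
    rw [writtenInExtChartAt_apply_extChartAt hy] at hρy
    exact (congrArg (extChartAt I x).symm hρy).trans ((extChartAt I x).left_inv hy)

theorem exists_contMDiffAt_localSection [CompleteSpace F] (hf : ContMDiffAt I J n f x)
    (hd : (mfderiv I J f x).HasRightInverse) (hn : n ≠ 0) :
    ∃ s : N → M, ContMDiffAt J I n s (f x) ∧ ∀ᶠ z in 𝓝 (f x), f (s z) = z := by
  obtain ⟨σ, hσ, hσx, hφσ⟩ := exists_contDiffAt_localSection (contDiffAt_writtenInExtChartAt hf)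
    (hasFDerivAt_writtenInExtChartAt (hf.mdifferentiableAt hn)) hd hn
  rw [writtenInExtChartAt_apply_extChartAt (mem_extChartAt_source x)] at hσ hσx hφσ
  let s : N → M := (extChartAt I x).symm ∘ σ ∘ extChartAt J (f x)
  have hs : ContMDiffAt J I n s (f x) :=
    ((contMDiffOn_extChartAt_symm (I := I) (n := n) x).contMDiffAt
      (extChartAt_target_mem_nhds x)).comp_of_eq
      (hσ.contMDiffAt.comp (f x) contMDiffAt_extChartAt) hσx
  have hsx : s (f x) = x := (congrArg (extChartAt I x).symm hσx).trans (extChartAt_to_inv x)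
  have hfs : Filter.Tendsto (f ∘ s) (𝓝 (f x)) (𝓝 (f x)) := by
    simpa only [ContinuousAt, Function.comp_apply, hsx] using
      hf.continuousAt.comp_of_eq hs.continuousAt hsx
  refine ⟨s, hs, ?_⟩
  filter_upwards [extChartAt_source_mem_nhds (I := J) (f x),
    hfs.eventually (extChartAt_source_mem_nhds (I := J) (f x)),
    (continuousAt_extChartAt (f x)).eventually hφσ] with z hz hfsz hφσz
  exact (extChartAt J (f x)).injOn hfsz hz hφσz

variable {G L P : Type*} [NormedAddCommGroup G] [NormedSpace 𝕜 G] [TopologicalSpace L]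
  {S : ModelWithCorners 𝕜 G L} [TopologicalSpace P] [ChartedSpace L P]

theorem contMDiffAt_of_comp_of_hasLeftInverse [CompleteSpace E] {h : P → M} {p : P}
    (hf : ContMDiffAt I J n f (h p)) (hd : (mfderiv I J f (h p)).HasLeftInverse) (hn : n ≠ 0)
    (hh : ContinuousAt h p) (hfh : ContMDiffAt S J n (f ∘ h) p) : ContMDiffAt S I n h p := by
  obtain ⟨g, hg, hgf⟩ := exists_contMDiffAt_localLeftInverse hf hd hn
  refine (ContMDiffAt.comp p hg hfh).congr_of_eventuallyEq ?_
  filter_upwards [hh.eventually hgf] with q hq using hq.symm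

theorem contMDiffAt_of_comp_of_hasRightInverse [CompleteSpace F] {g : N → P}
    (hf : ContMDiffAt I J n f x) (hd : (mfderiv I J f x).HasRightInverse) (hn : n ≠ 0)
    (hgf : ContMDiff I S n (g ∘ f)) : ContMDiffAt J S n g (f x) := by
  obtain ⟨s, hs, hfs⟩ := exists_contMDiffAt_localSection hf hd hn
  refine (ContMDiffAt.comp (f x) (hgf (s (f x))) hs).congr_of_eventuallyEq ?_
  filter_upwards [hfs] with z hz using congrArg g hz.symm

end

/-! ### Transport of manifold structures -/

section
variable {H H' : Type*} [TopologicalSpace H] [TopologicalSpace H']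
  {M X : Type*} [TopologicalSpace M] [ChartedSpace H M] [TopologicalSpace X]

/-- The charted space structure on `X` carried over from `M` by a homeomorphism `h : X ≃ₜ M`, each
chart being composed with a homeomorphism `k` from the old model space to the new one. -/
abbrev transportedChartedSpace (h : X ≃ₜ M) (k : H ≃ₜ H') : ChartedSpace H' X where
  atlas := (fun c => (h.toOpenPartialHomeomorph ≫ₕ c) ≫ₕ k.toOpenPartialHomeomorph) '' atlas H M
  chartAt x := (h.toOpenPartialHomeomorph ≫ₕ chartAt H (h x)) ≫ₕ k.toOpenPartialHomeomorph
  mem_chart_source x := by simp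
  chart_mem_atlas x := ⟨_, chart_mem_atlas H (h x), rfl⟩

end

section
variable {𝕜 : Type*} [NontriviallyNormedField 𝕜] {n : ℕ∞ω}
  {E E' : Type*} [NormedAddCommGroup E] [NormedSpace 𝕜 E] [NormedAddCommGroup E']
  [NormedSpace 𝕜 E'] {H : Type*} [TopologicalSpace H] {I : ModelWithCorners 𝕜 E H} [I.Boundaryless]
  {M X : Type*} [TopologicalSpace M] [ChartedSpace H M] [IsManifold I n M]
  [TopologicalSpace X] (h : X ≃ₜ M) (L : E ≃L[𝕜] E')

theorem isManifold_transportedChartedSpace :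
    let _ := transportedChartedSpace h (I.toHomeomorph.trans L.toHomeomorph)
    IsManifold 𝓘(𝕜, E') n X := by
  intro _
  refine isManifold_of_contDiffOn _ _ _ ?_
  rintro _ _ ⟨c, hc, rfl⟩ ⟨c', hc', rfl⟩
  have hcc' : ContDiffOn 𝕜 n (I ∘ (c.symm ≫ₕ c') ∘ I.symm)
      (I.symm ⁻¹' (c.symm ≫ₕ c').source ∩ Set.range I) :=
    (contDiffGroupoid n I).compatible hc hc' |>.1
  refine ((L.contDiff.comp_contDiffOn (hcc'.comp L.symm.contDiff.contDiffOn
    (Set.mapsTo_preimage L.symm _))).congr ?_).mono ?_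
  · intro z _
    simp
  · intro z hz
    exact ⟨by simpa using hz, by rw [I.range_eq_univ]; trivial⟩

theorem contMDiff_transportedChartedSpace :
    let _ := transportedChartedSpace h (I.toHomeomorph.trans L.toHomeomorph)
    ContMDiff 𝓘(𝕜, E') I n h := by
  intro _ x
  have hchart : ∀ y, extChartAt 𝓘(𝕜, E') x y = L (extChartAt I (h x) (h y)) := fun _ => rfl
  have hsmooth : ContMDiffAt 𝓘(𝕜, E') I n
      ((extChartAt I (h x)).symm ∘ L.symm ∘ extChartAt 𝓘(𝕜, E') x) x := by
    refine ContMDiffAt.comp_of_eq ((contMDiffOn_extChartAt_symm (h x)).contMDiffAt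
      (extChartAt_target_mem_nhds (h x)))
      (L.symm.contDiff.contMDiff.contMDiffAt.comp x contMDiffAt_extChartAt) ?_
    rw [Function.comp_apply, hchart, L.symm_apply_apply]
  refine hsmooth.congr_of_eventuallyEq ?_
  filter_upwards [h.continuous.continuousAt.eventually
    (extChartAt_source_mem_nhds (I := I) (h x))] with y hy
  rw [Function.comp_apply, Function.comp_apply, hchart, L.symm_apply_apply]
  exact ((extChartAt I (h x)).left_inv hy).symm

omit [IsManifold I n M] in
theorem contMDiff_symm_transportedChartedSpace :
    let _ := transportedChartedSpace h (I.toHomeomorph.trans L.toHomeomorph)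
    ContMDiff I 𝓘(𝕜, E') n h.symm := by
  intro _ y
  have hL := L.contDiff.contMDiff.contMDiffAt.comp y
    (contMDiffAt_extChartAt (I := I) (x := y) (n := n))
  refine contMDiffAt_iff_target.2 ⟨h.symm.continuous.continuousAt, hL.congr_of_eventuallyEq ?_⟩
  filter_upwards with z
  change L (extChartAt I (h (h.symm y)) (h (h.symm z))) = L (extChartAt I y z)
  rw [h.apply_symm_apply, h.apply_symm_apply]

include L in
theorem exists_chartedSpace_diffeomorph :
    ∃ _ : ChartedSpace E' X, IsManifold 𝓘(𝕜, E') n X ∧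
      ∃ Φ : X ≃ₘ^n⟮𝓘(𝕜, E'), I⟯ M, ⇑Φ = h := by
  let _ := transportedChartedSpace h (I.toHomeomorph.trans L.toHomeomorph)
  exact ⟨inferInstance, isManifold_transportedChartedSpace h L,
    ⟨h.toEquiv, contMDiff_transportedChartedSpace h L,
      contMDiff_symm_transportedChartedSpace h L⟩, rfl⟩

end

section
variable {𝕜 : Type*} [NontriviallyNormedField 𝕜] {n : ℕ∞ω}
  {E : Type*} [NormedAddCommGroup E] [NormedSpace 𝕜 E]
  {H : Type*} [TopologicalSpace H] {I : ModelWithCorners 𝕜 E H}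
  {F : Type*} [NormedAddCommGroup F] [NormedSpace 𝕜 F]
  {K : Type*} [TopologicalSpace K] {J : ModelWithCorners 𝕜 F K}
  {G : Type*} [TopologicalSpace G] [ChartedSpace H G] [Group G] [IsManifold I n G]
  {G' : Type*} [TopologicalSpace G'] [ChartedSpace K G'] [Group G'] [LieGroup J n G']

theorem lieGroup_of_diffeomorph (Φ : G ≃ₘ^n⟮I, J⟯ G') (hΦ : ∀ g h, Φ (g * h) = Φ g * Φ h) :
    LieGroup I n G where
  contMDiff_mul := by
    refine (Φ.symm.contMDiff.comp ((Φ.contMDiff.comp contMDiff_fst).mul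
      (Φ.contMDiff.comp contMDiff_snd))).congr fun p => ?_
    exact (Φ.symm_apply_apply _).symm.trans (congrArg Φ.symm (hΦ p.1 p.2))
  contMDiff_inv := by
    refine (Φ.symm.contMDiff.comp Φ.contMDiff.inv).congr fun g => ?_
    exact (Φ.symm_apply_apply _).symm.trans (congrArg Φ.symm (map_inv (MonoidHom.mk' Φ hΦ) g))

end

section
variable {𝕜 : Type*} [NontriviallyNormedField 𝕜]
  {E : Type*} [NormedAddCommGroup E] [NormedSpace 𝕜 E]
  {H : Type*} [TopologicalSpace H] {I : ModelWithCorners 𝕜 E H}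
  {F : Type*} [NormedAddCommGroup F] [NormedSpace 𝕜 F]
  {K : Type*} [TopologicalSpace K] {J : ModelWithCorners 𝕜 F K}
  {G : Type*} [NormedAddCommGroup G] [NormedSpace 𝕜 G]
  {L : Type*} [TopologicalSpace L] {S : ModelWithCorners 𝕜 G L}
  {M : Type*} [TopologicalSpace M] [ChartedSpace H M]
  {N : Type*} [TopologicalSpace N] [ChartedSpace K N]
  {P : Type*} [TopologicalSpace P] [ChartedSpace L P]
  {f : M → N} {g : N → P} {x : M}

theorem mfderiv_injective_of_comp (hg : MDifferentiableAt J S g (f x))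
    (hf : MDifferentiableAt I J f x) (h : Function.Injective (mfderiv I S (g ∘ f) x)) :
    Function.Injective (mfderiv I J f x) := by
  rw [mfderiv_comp x hg hf, ContinuousLinearMap.coe_comp] at h
  exact h.of_comp

theorem mfderiv_surjective_of_comp (hg : MDifferentiableAt J S g (f x))
    (hf : MDifferentiableAt I J f x) (h : Function.Surjective (mfderiv I S (g ∘ f) x)) :
    Function.Surjective (mfderiv J S g (f x)) := by
  rw [mfderiv_comp x hg hf, ContinuousLinearMap.coe_comp] at h
  exact h.of_comp

end

section
variable {E F : Type*} [NormedAddCommGroup E] [NormedSpace ℝ E]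
  [NormedAddCommGroup F] [NormedSpace ℝ F]
  {G K : Type*} [NormedAddCommGroup G] [NormedSpace ℝ G] [TopologicalSpace K]
  {J : ModelWithCorners ℝ G K}
  {M N P : Type*} [TopologicalSpace M] [ChartedSpace E M]
  [TopologicalSpace N] [ChartedSpace F N] [TopologicalSpace P] [ChartedSpace K P]
  {f : M → N}

theorem IsSmoothSubmersion.contMDiff_of_comp [CompleteSpace E] [FiniteDimensional ℝ F]
    [IsManifold 𝓘(ℝ, E) ∞ M] (hf : IsSmoothSubmersion E F f) {g : N → P}
    (hgf : ContMDiff 𝓘(ℝ, E) J ∞ (g ∘ f)) : ContMDiff 𝓘(ℝ, F) J ∞ g := by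
  have := FiniteDimensional.complete ℝ F
  intro y
  obtain ⟨x, rfl⟩ := hf.surjective y
  let D : E →L[ℝ] F := mfderiv 𝓘(ℝ, E) 𝓘(ℝ, F) f x
  have hD : D.HasRightInverse := .of_surjective_of_finiteDimensional (hf.mfderiv_surjective x)
  exact contMDiffAt_of_comp_of_hasRightInverse hf.contMDiff.contMDiffAt hD (by simp) hgf

theorem IsEmbeddingOfManifolds.contMDiff_of_comp [CompleteSpace E] [FiniteDimensional ℝ F]
    [IsManifold 𝓘(ℝ, E) ∞ M] (hf : IsEmbeddingOfManifolds E F f) {h : P → M}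
    (hfh : ContMDiff J 𝓘(ℝ, F) ∞ (f ∘ h)) : ContMDiff J 𝓘(ℝ, E) ∞ h := by
  have hh : Continuous h := hf.isEmbedding.continuous_iff.2 hfh.continuous
  intro p
  let D : E →L[ℝ] F := mfderiv 𝓘(ℝ, E) 𝓘(ℝ, F) f (h p)
  have hD : D.HasLeftInverse := .of_injective_of_finiteDimensional (hf.mfderiv_injective (h p))
  exact contMDiffAt_of_comp_of_hasLeftInverse hf.contMDiff.contMDiffAt hD (by simp)
    hh.continuousAt (hfh p)

/-- A bijection `e` of an embedded submanifold with a manifold `P` is a diffeomorphism if it is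
smooth and the parametrisation of the submanifold by `e.symm` is smooth into the ambient space. -/
def IsEmbeddingOfManifolds.diffeomorph [CompleteSpace E] [FiniteDimensional ℝ F]
    [IsManifold 𝓘(ℝ, E) ∞ M] (hf : IsEmbeddingOfManifolds E F f) (e : M ≃ P)
    (he : ContMDiff 𝓘(ℝ, E) J ∞ e) (hfe : ContMDiff J 𝓘(ℝ, F) ∞ (f ∘ e.symm)) :
    M ≃ₘ^∞⟮𝓘(ℝ, E), J⟯ P :=
  ⟨e, he, hf.contMDiff_of_comp hfe⟩

theorem isEmbeddingOfManifolds_of_leftInverse (hf : ContMDiff 𝓘(ℝ, E) 𝓘(ℝ, F) ∞ f) {g : N → M}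
    (hg : ContMDiff 𝓘(ℝ, F) 𝓘(ℝ, E) ∞ g) (hgf : Function.LeftInverse g f) :
    IsEmbeddingOfManifolds E F f where
  contMDiff := hf
  isEmbedding := hgf.isEmbedding hg.continuous hf.continuous
  mfderiv_injective x := by
    refine mfderiv_injective_of_comp (hg.mdifferentiableAt (by simp))
      (hf.mdifferentiableAt (by simp)) ?_
    rw [hgf.comp_eq_id, mfderiv_id]
    exact Function.injective_id

end

section
variable {E F : Type*} [NormedAddCommGroup E] [NormedSpace ℝ E]
  [NormedAddCommGroup F] [NormedSpace ℝ F]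
  {G K : Type*} [NormedAddCommGroup G] [NormedSpace ℝ G] [TopologicalSpace K]
  {J : ModelWithCorners ℝ G K}
  {G' K' : Type*} [NormedAddCommGroup G'] [NormedSpace ℝ G'] [TopologicalSpace K']
  {J' : ModelWithCorners ℝ G' K'}
  {M N P Q : Type*} [TopologicalSpace M] [ChartedSpace E M]
  [TopologicalSpace N] [ChartedSpace F N] [TopologicalSpace P] [ChartedSpace K P]
  [TopologicalSpace Q] [ChartedSpace K' Q]
  {f : M → N}

theorem isSmoothSubmersion_of_diffeomorph_prod [Nonempty P]
    (Φ : M ≃ₘ^∞⟮𝓘(ℝ, E), J.prod J'⟯ (P × Q)) (Ψ : N ≃ₘ^∞⟮𝓘(ℝ, F), J'⟯ Q)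
    (hf : ∀ x, Ψ (f x) = (Φ x).2) : IsSmoothSubmersion E F f := by
  have hsection (p : P) : Function.RightInverse (fun z => Φ.symm (p, Ψ z)) f := fun z =>
    Ψ.injective ((hf _).trans (by rw [Φ.apply_symm_apply]; rfl))
  have hf_smooth : ContMDiff 𝓘(ℝ, E) 𝓘(ℝ, F) ∞ f :=
    (Ψ.symm.contMDiff.comp (contMDiff_snd.comp Φ.contMDiff)).congr fun x =>
      (Ψ.symm_apply_eq.2 (hf x).symm).symm
  refine ⟨hf_smooth, (hsection (Classical.arbitrary P)).surjective, fun x => ?_⟩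
  let s : N → M := fun z => Φ.symm ((Φ x).1, Ψ z)
  have hs : ContMDiff 𝓘(ℝ, F) 𝓘(ℝ, E) ∞ s :=
    Φ.symm.contMDiff.comp (contMDiff_const.prodMk Ψ.contMDiff)
  have hsx : s (f x) = x := by simp only [s, hf, Prod.mk.eta, Φ.symm_apply_apply]
  rw [← hsx]
  refine mfderiv_surjective_of_comp (hf_smooth.mdifferentiableAt (by simp))
    (hs.mdifferentiableAt (by simp)) ?_
  rw [(hsection _).comp_eq_id, mfderiv_id]
  exact Function.surjective_id

/-- If a submersion becomes the projection of a product onto its second factor through a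
diffeomorphism of the source and a bijection `e` of the target, then `e` is a diffeomorphism. -/
def IsSmoothSubmersion.diffeomorph [Nonempty P] [CompleteSpace E] [FiniteDimensional ℝ F]
    [IsManifold 𝓘(ℝ, E) ∞ M] (hf : IsSmoothSubmersion E F f)
    (Φ : M ≃ₘ^∞⟮𝓘(ℝ, E), J.prod J'⟯ (P × Q)) (e : N ≃ Q) (he : ∀ x, e (f x) = (Φ x).2) :
    N ≃ₘ^∞⟮𝓘(ℝ, F), J'⟯ Q where
  toEquiv := e
  contMDiff_toFun := hf.contMDiff_of_comp
    ((contMDiff_snd.comp Φ.contMDiff).congr he)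
  contMDiff_invFun := by
    refine (hf.contMDiff.comp (Φ.symm.contMDiff.comp
      (contMDiff_const (c := Classical.arbitrary P) |>.prodMk contMDiff_id))).congr fun y => ?_
    refine e.symm_apply_eq.2 ?_
    simp only [Function.comp_apply, he, Φ.apply_symm_apply, id]

end

/-! ### Coordinates on `Sp(1,1)` -/

/-- The group `Sp(1)` of unit quaternions, as a sphere so that it carries Mathlib's manifold
structure. -/
abbrev UnitSphere : Type := Metric.sphere (0 : ℍ[ℝ]) 1

namespace UnitSphere

theorem norm_eq_one (u : UnitSphere) : ‖(u : ℍ[ℝ])‖ = 1 := norm_eq_of_mem_sphere u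

theorem star_mul_self (u : UnitSphere) : star (u : ℍ[ℝ]) * u = 1 := by
  rw [Quaternion.star_mul_self, Quaternion.normSq_eq_norm_mul_self, u.norm_eq_one, one_mul,
    Quaternion.coe_one]

theorem self_mul_star (u : UnitSphere) : (u : ℍ[ℝ]) * star (u : ℍ[ℝ]) = 1 := by
  rw [Quaternion.self_mul_star, Quaternion.normSq_eq_norm_mul_self, u.norm_eq_one, one_mul,
    Quaternion.coe_one]

theorem coe_inv (u : UnitSphere) : ((u⁻¹ : UnitSphere) : ℍ[ℝ]) = star (u : ℍ[ℝ]) :=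
  inv_eq_of_mul_eq_one_right u.self_mul_star

end UnitSphere

theorem star_mul_self_eq_smul_one (x : ℍ[ℝ]) : star x * x = ‖x‖ ^ 2 • (1 : ℍ[ℝ]) := by
  rw [Quaternion.star_mul_self, Quaternion.normSq_eq_norm_mul_self, ← sq,
    ← Quaternion.coe_mul_eq_smul, mul_one]

theorem self_mul_star_eq_smul_one (x : ℍ[ℝ]) : x * star x = ‖x‖ ^ 2 • (1 : ℍ[ℝ]) := by
  simpa using star_mul_self_eq_smul_one (star x)

instance : StarModule ℝ ℍ[ℝ] := ⟨fun r x => Quaternion.star_smul r x⟩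

/-- The factor `(1 - |p|²)^(-1/2)`, which normalizes `(1 p*; p 1)` to an element of `Sp(1,1)`. -/
def boostFactor (p : ℍ[ℝ]) : ℝ := (√(1 - ‖p‖ ^ 2))⁻¹

theorem one_sub_norm_sq_pos (p : UnitBall) : 0 < 1 - ‖(p : ℍ[ℝ])‖ ^ 2 :=
  sub_pos.mpr ((sq_lt_one_iff₀ (norm_nonneg _)).mpr (UnitBall.norm_lt p))

theorem boostFactor_pos (p : UnitBall) : 0 < boostFactor p :=
  inv_pos.mpr (Real.sqrt_pos.mpr (one_sub_norm_sq_pos p))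

theorem boostFactor_sq_mul (p : UnitBall) : boostFactor p ^ 2 * (1 - ‖(p : ℍ[ℝ])‖ ^ 2) = 1 := by
  rw [boostFactor, inv_pow, Real.sq_sqrt (one_sub_norm_sq_pos p).le,
    inv_mul_cancel₀ (one_sub_norm_sq_pos p).ne']

theorem continuous_boostFactor : Continuous fun p : UnitBall => boostFactor p := by
  unfold boostFactor
  exact Continuous.inv₀ (by fun_prop) fun p => (Real.sqrt_pos.mpr (one_sub_norm_sq_pos p)).ne'

namespace Sp11

variable (A : Sp11)

theorem coe_inv : ((A⁻¹ : Sp11) : Matrix (Fin 2) (Fin 2) ℍ[ℝ]) =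
    !![star (A.1 0 0), -star (A.1 1 0); -star (A.1 0 1), star (A.1 1 1)] := by
  change I11 * A.1ᴴ * I11 = _
  ext i j : 1
  fin_cases i <;> fin_cases j <;>
    simp [I11, Matrix.mul_apply, Fin.sum_univ_two, Matrix.vecMul, dotProduct]

theorem norm_denom_pos : 0 < ‖A.1 1 1‖ := (norm_nonneg _).trans_lt (norm_c_lt_d A.2)

theorem denom_ne_zero : A.1 1 1 ≠ 0 := norm_pos_iff.mp (norm_denom_pos A)

theorem norm_apply_zero_zero : ‖A.1 0 0‖ = ‖A.1 1 1‖ := by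
  have hrow := row00 A.2
  have hcol := col11 A.2
  rw [Quaternion.normSq_eq_norm_mul_self, Quaternion.normSq_eq_norm_mul_self] at hrow hcol
  exact (mul_self_inj (norm_nonneg _) (norm_nonneg _)).mp (by linarith)

theorem norm_apply_one_zero_sq : ‖A.1 1 0‖ ^ 2 = ‖A.1 1 1‖ ^ 2 - 1 := by
  have hcol := col00 A.2
  rw [Quaternion.normSq_eq_norm_mul_self, Quaternion.normSq_eq_norm_mul_self,
    norm_apply_zero_zero A] at hcol
  linarith

theorem one_sub_norm_apply_mul_inv_sq :
    1 - ‖A.1 1 0 * (A.1 1 1)⁻¹‖ ^ 2 = (‖A.1 1 1‖ ^ 2)⁻¹ := by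
  have hd := (norm_denom_pos A).ne'
  rw [norm_mul, norm_inv, mul_pow, norm_apply_one_zero_sq A]
  field_simp
  ring

/-- The coordinate `d / |d|` of `(a c; b d) ∈ Sp(1,1)`. It spans the fibres of `A ↦ 𝓕_{A⁻¹}`. -/
def phase : UnitSphere :=
  ⟨‖A.1 1 1‖⁻¹ • A.1 1 1, mem_sphere_zero_iff_norm.mpr (norm_smul_inv_norm (denom_ne_zero A))⟩

/-- The coordinate `a d⁻¹` of `(a c; b d) ∈ Sp(1,1)`, a unit quaternion as `|a| = |d|`. -/
def twist : UnitSphere :=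
  ⟨A.1 0 0 * (A.1 1 1)⁻¹, mem_sphere_zero_iff_norm.mpr (by
    rw [norm_mul, norm_inv, norm_apply_zero_zero A, mul_inv_cancel₀ (norm_denom_pos A).ne'])⟩

/-- The coordinate `b d⁻¹` of `A = (a c; b d) ∈ Sp(1,1)`. It is the zero of `𝓕_{A⁻¹}`. -/
def root : UnitBall :=
  ⟨A.1 1 0 * (A.1 1 1)⁻¹, mem_ball_zero_iff.mpr (by
    have hpos : 0 < (‖A.1 1 1‖ ^ 2)⁻¹ := inv_pos.mpr (pow_pos (norm_denom_pos A) 2)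
    rw [← one_sub_norm_apply_mul_inv_sq A] at hpos
    exact (sq_lt_one_iff₀ (norm_nonneg _)).mp (sub_pos.mp hpos))⟩

theorem apply_zero_zero : A.1 0 0 = twist A * A.1 1 1 :=
  (inv_mul_cancel_right₀ (denom_ne_zero A) _).symm

theorem apply_one_zero : A.1 1 0 = root A * A.1 1 1 :=
  (inv_mul_cancel_right₀ (denom_ne_zero A) _).symm

theorem apply_zero_one : A.1 0 1 = twist A * star (root A : ℍ[ℝ]) * A.1 1 1 := by
  have hstar : star (twist A : ℍ[ℝ]) * A.1 0 1 = star (root A : ℍ[ℝ]) * A.1 1 1 := by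
    simp only [twist, root, star_mul, mul_assoc, col01 A.2]
  rw [mul_assoc, ← hstar, ← mul_assoc, (twist A).self_mul_star, one_mul]

theorem boostFactor_root : boostFactor (root A) = ‖A.1 1 1‖ := by
  rw [boostFactor, root, one_sub_norm_apply_mul_inv_sq A, Real.sqrt_inv,
    Real.sqrt_sq (norm_nonneg _), inv_inv]

/-- The element `diag(u, v)` of `Sp(1,1)`. -/
def diag (u v : UnitSphere) : Sp11 :=
  ⟨!![(u : ℍ[ℝ]), 0; 0, (v : ℍ[ℝ])], by
    change !![(u : ℍ[ℝ]), 0; 0, (v : ℍ[ℝ])]ᴴ * I11 * !![(u : ℍ[ℝ]), 0; 0, (v : ℍ[ℝ])] = I11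
    ext i j : 1
    fin_cases i <;> fin_cases j <;>
      simp [Matrix.mul_apply, Fin.sum_univ_two, I11, UnitSphere.star_mul_self]⟩

theorem conjTranspose_mul_I11_mul (p : ℍ[ℝ]) :
    !![1, star p; p, 1]ᴴ * I11 * !![1, star p; p, 1] = (1 - ‖p‖ ^ 2) • I11 := by
  ext i j : 1
  fin_cases i <;> fin_cases j <;>
    simp [Matrix.mul_apply, Fin.sum_univ_two, I11, star_mul_self_eq_smul_one,
      self_mul_star_eq_smul_one, add_smul, sub_eq_add_neg, add_comm]

/-- The positive element `(1 - |p|²)^(-1/2) (1 p*; p 1)` of `Sp(1,1)`. -/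
def boost (p : UnitBall) : Sp11 :=
  ⟨boostFactor p • !![1, star (p : ℍ[ℝ]); (p : ℍ[ℝ]), 1], by
    change (boostFactor p • !![1, star (p : ℍ[ℝ]); (p : ℍ[ℝ]), 1])ᴴ * I11 *
      (boostFactor p • !![1, star (p : ℍ[ℝ]); (p : ℍ[ℝ]), 1]) = I11
    rw [Matrix.conjTranspose_smul, Matrix.smul_mul, Matrix.smul_mul, Matrix.mul_smul,
      conjTranspose_mul_I11_mul, smul_smul, smul_smul, star_trivial, ← sq, boostFactor_sq_mul,
      one_smul]⟩

/-- The element of `Sp(1,1)` with phase `v`, twist `u` and root `p`. -/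
def ofCoords (x : UnitSphere × UnitSphere × UnitBall) : Sp11 :=
  diag x.2.1 1 * boost x.2.2 * diag x.1 x.1

theorem coe_ofCoords (v u : UnitSphere) (p : UnitBall) :
    (ofCoords (v, u, p)).1 = boostFactor p •
      !![(u : ℍ[ℝ]) * v, u * star (p : ℍ[ℝ]) * v; (p : ℍ[ℝ]) * v, (v : ℍ[ℝ])] := by
  change (diag u 1).1 * (boost p).1 * (diag v v).1 = _
  ext i j : 1
  fin_cases i <;> fin_cases j <;>
    simp [diag, boost, Matrix.mul_apply, Fin.sum_univ_two]

theorem ofCoords_phase_twist_root : ofCoords (phase A, twist A, root A) = A := by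
  have hphase (x : ℍ[ℝ]) : ‖A.1 1 1‖ • (x * phase A) = x * A.1 1 1 := by
    rw [phase, mul_smul_comm, smul_inv_smul₀ (norm_denom_pos A).ne']
  refine Subtype.ext ?_
  rw [coe_ofCoords, boostFactor_root]
  ext i j : 1
  fin_cases i <;> fin_cases j
  · exact (hphase _).trans (apply_zero_zero A).symm
  · exact (hphase _).trans (apply_zero_one A).symm
  · exact (hphase _).trans (apply_one_zero A).symm
  · simpa using hphase 1

theorem ofCoords_apply_one_one (v u : UnitSphere) (p : UnitBall) :
    (ofCoords (v, u, p)).1 1 1 = boostFactor p • (v : ℍ[ℝ]) := by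
  simp [coe_ofCoords]

theorem phase_ofCoords (v u : UnitSphere) (p : UnitBall) : phase (ofCoords (v, u, p)) = v := by
  have hβ := boostFactor_pos p
  refine Subtype.ext ?_
  change ‖(ofCoords (v, u, p)).1 1 1‖⁻¹ • (ofCoords (v, u, p)).1 1 1 = (v : ℍ[ℝ])
  rw [ofCoords_apply_one_one, norm_smul, v.norm_eq_one, mul_one, Real.norm_eq_abs,
    abs_of_pos hβ, inv_smul_smul₀ hβ.ne']

theorem twist_ofCoords (v u : UnitSphere) (p : UnitBall) : twist (ofCoords (v, u, p)) = u := by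
  refine Subtype.ext ((eq_mul_inv_iff_mul_eq₀ (denom_ne_zero _)).mpr ?_).symm
  simp [coe_ofCoords]

theorem root_ofCoords (v u : UnitSphere) (p : UnitBall) : root (ofCoords (v, u, p)) = p := by
  refine Subtype.ext ((eq_mul_inv_iff_mul_eq₀ (denom_ne_zero _)).mpr ?_).symm
  simp [coe_ofCoords]

theorem continuous_ofCoords : Continuous ofCoords := by
  have hβ : Continuous fun x : UnitSphere × UnitSphere × UnitBall => boostFactor x.2.2 :=
    continuous_boostFactor.comp (by fun_prop)
  refine continuous_induced_rng.mpr ((hβ.smul ?_).congr fun x => (coe_ofCoords _ _ _).symm)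
  refine continuous_pi fun i => continuous_pi fun j => ?_
  fin_cases i <;> fin_cases j <;> dsimp <;> fun_prop

theorem continuous_entry (i j : Fin 2) : Continuous fun A : Sp11 => A.1 i j :=
  (continuous_apply_apply i j).comp continuous_subtype_val

theorem continuous_inv_denom : Continuous fun A : Sp11 => (A.1 1 1)⁻¹ :=
  (continuous_entry 1 1).inv₀ denom_ne_zero

theorem continuous_phase : Continuous phase :=
  (((continuous_entry 1 1).norm.inv₀ fun A => (norm_denom_pos A).ne').smul
    (continuous_entry 1 1)).subtype_mk _

theorem continuous_twist : Continuous twist :=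
  ((continuous_entry 0 0).mul continuous_inv_denom).subtype_mk _

theorem continuous_root : Continuous root :=
  ((continuous_entry 1 0).mul continuous_inv_denom).subtype_mk _

/-- The coordinates `(d / |d|, a d⁻¹, b d⁻¹)` identify `Sp(1,1)` with `Sp(1) × Sp(1) × 𝔹`. -/
def coord : Sp11 ≃ₜ UnitSphere × UnitSphere × UnitBall where
  toFun A := (phase A, twist A, root A)
  invFun := ofCoords
  left_inv := ofCoords_phase_twist_root
  right_inv _ := Prod.ext (phase_ofCoords _ _ _)
    (Prod.ext (twist_ofCoords _ _ _) (root_ofCoords _ _ _))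
  continuous_toFun :=
    continuous_phase.prodMk (continuous_twist.prodMk continuous_root)
  continuous_invFun := continuous_ofCoords

end Sp11

/-! ### Coordinates on `𝓜(𝔹)`, the isotropy and the orbit space -/

section
open Topology
variable {X Y Z : Type*} [TopologicalSpace X] [TopologicalSpace Y] [TopologicalSpace Z]
  {f : C(X, Y)} {g : C(X, Z)}

theorem lift_lift_of_isQuotientMap (hf : IsQuotientMap f) (hg : IsQuotientMap g)
    (hfg : Function.FactorsThrough g f) (hgf : Function.FactorsThrough f g) (y : Y) :
    hg.lift f hgf (hf.lift g hfg y) = y := by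
  obtain ⟨x, rfl⟩ := hf.surjective y
  exact (congrArg _ (ContinuousMap.congr_fun (hf.lift_comp g hfg) x)).trans
    (ContinuousMap.congr_fun (hg.lift_comp f hgf) x)

/-- The canonical homeomorphism between the targets of two quotient maps which identify the same
pairs of points. -/
def homeomorphOfIsQuotientMap (hf : IsQuotientMap f) (hg : IsQuotientMap g)
    (h : ∀ a b, f a = f b ↔ g a = g b) : Y ≃ₜ Z where
  toFun := hf.lift g fun a b => (h a b).mp
  invFun := hg.lift f fun a b => (h a b).mpr
  left_inv := lift_lift_of_isQuotientMap hf hg _ _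
  right_inv := lift_lift_of_isQuotientMap hg hf _ _

theorem homeomorphOfIsQuotientMap_apply (hf : IsQuotientMap f) (hg : IsQuotientMap g)
    (h : ∀ a b, f a = f b ↔ g a = g b) (a : X) : homeomorphOfIsQuotientMap hf hg h (f a) = g a :=
  ContinuousMap.congr_fun (hf.lift_comp g fun a b => (h a b).mp) a

end

theorem toRegularMobius_apply (A : Sp11) (q : UnitBall) {T : ℍ[ℝ]}
    (hT : T - q * T * star (Sp11.root A : ℍ[ℝ]) = 1) :
    (toRegularMobius A q : ℍ[ℝ]) =
      (q * T - T * Sp11.root A) * star (Sp11.twist A : ℍ[ℝ]) := by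
  have hd : star (A.1 1 1) ≠ 0 := star_ne_zero.mpr (Sp11.denom_ne_zero A)
  set S := T * (star (A.1 1 1))⁻¹
  have hS : S * star (A.1 1 1) = T := inv_mul_cancel_right₀ hd T
  have hcancel (x : ℍ[ℝ]) : S * (star (A.1 1 1) * x) = T * x := by rw [← mul_assoc, hS]
  change mobiusVal (A⁻¹ : Sp11).1 q = _
  rw [Sp11.mobiusVal_eq (A⁻¹ : Sp11).2 q (S := S)]
  · simp only [Sp11.coe_inv, Sp11.apply_zero_one, Sp11.apply_zero_zero A, Matrix.of_apply,
      Matrix.cons_val', Matrix.cons_val_zero, Matrix.cons_val_one, Matrix.cons_val_fin_one,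
      star_mul, star_star, mul_neg, mul_assoc, hcancel, sub_mul]
    abel
  · simpa [Sp11.coe_inv, Sp11.apply_one_zero A, hS, hcancel, sub_eq_add_neg, mul_assoc] using hT

theorem exists_sub_mul_mul_star_eq_one (p q : UnitBall) :
    ∃ T : ℍ[ℝ], T - q * T * star (p : ℍ[ℝ]) = 1 := by
  have hp : ‖-star (p : ℍ[ℝ])‖ < ‖(1 : ℍ[ℝ])‖ := by simpa using UnitBall.norm_lt p
  exact ⟨_, by simpa [sub_eq_add_neg] using (starInv_lin hp).2 q⟩

theorem toRegularMobius_root (A : Sp11) : toRegularMobius A (Sp11.root A) = origin := by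
  set p := Sp11.root A
  have hT : (1 - ‖(p : ℍ[ℝ])‖ ^ 2)⁻¹ • (1 : ℍ[ℝ]) -
      p * (1 - ‖(p : ℍ[ℝ])‖ ^ 2)⁻¹ • (1 : ℍ[ℝ]) * star (p : ℍ[ℝ]) = 1 := by
    rw [mul_smul_comm, mul_one, smul_mul_assoc, self_mul_star_eq_smul_one, smul_smul, ← sub_smul,
      ← mul_one_sub, inv_mul_cancel₀ (one_sub_norm_sq_pos p).ne', one_smul]
  exact Subtype.ext ((toRegularMobius_apply A p hT).trans (by simp [p, origin]))

theorem inverseOrbit_eq_iff {F : RegularMobius} {p : UnitBall} :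
    inverseOrbit F = p ↔ F p = origin :=
  (Equiv.symm_apply_eq _).trans eq_comm

theorem inverseOrbit_toRegularMobius (A : Sp11) : inverseOrbit (toRegularMobius A) = Sp11.root A :=
  inverseOrbit_eq_iff.mpr (toRegularMobius_root A)

instance : Nontrivial UnitBall where
  exists_pair_ne := by
    have hmem : ((1 / 2 : ℝ) : ℍ[ℝ]) ∈ UnitBall := mem_ball_zero_iff.mpr (by norm_num)
    exact ⟨origin, ⟨_, hmem⟩, fun h => by
      simpa [origin] using congrArg (fun q : UnitBall => ‖(q : ℍ[ℝ])‖) h⟩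

theorem toRegularMobius_eq_iff (A B : Sp11) :
    toRegularMobius A = toRegularMobius B ↔ (Sp11.coord A).2 = (Sp11.coord B).2 := by
  change _ ↔ (Sp11.twist A, Sp11.root A) = (Sp11.twist B, Sp11.root B)
  rw [Prod.mk.injEq]
  constructor
  · intro h
    have hroot : Sp11.root A = Sp11.root B := by
      rw [← inverseOrbit_toRegularMobius, h, inverseOrbit_toRegularMobius]
    obtain ⟨q, hq⟩ := exists_ne (Sp11.root A)
    obtain ⟨T, hT⟩ := exists_sub_mul_mul_star_eq_one (Sp11.root A) q
    have hne : toRegularMobius A q ≠ origin := by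
      rw [← toRegularMobius_root A]
      exact (toRegularMobius A).bijective.injective.ne hq
    have hA := toRegularMobius_apply A q hT
    have hB := toRegularMobius_apply B q (hroot ▸ hT)
    have hnum : (q : ℍ[ℝ]) * T - T * Sp11.root A ≠ 0 := fun h0 =>
      hne (Subtype.ext (hA.trans (by rw [h0, zero_mul]; rfl)))
    rw [← h, hA, ← hroot] at hB
    exact ⟨Subtype.ext (star_injective (mul_left_cancel₀ hnum hB)), hroot⟩
  · rintro ⟨htwist, hroot⟩
    refine RegularMobius.ext fun q => Subtype.ext ?_
    obtain ⟨T, hT⟩ := exists_sub_mul_mul_star_eq_one (Sp11.root A) q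
    rw [toRegularMobius_apply A q hT, toRegularMobius_apply B q (hroot ▸ hT), htwist, hroot]

theorem isQuotientMap_toRegularMobius : Topology.IsQuotientMap toRegularMobius where
  surjective := by
    rintro ⟨_, A, rfl⟩
    exact ⟨A⁻¹, Subtype.ext (by simp [toRegularMobius])⟩
  isCoinducing := ⟨rfl⟩

/-- The coordinates `(a d⁻¹, b d⁻¹)` of `𝓕_{A⁻¹}`, `A = (a c; b d)`, identify `𝓜(𝔹)` with
`Sp(1) × 𝔹`. -/
def RegularMobius.coord : RegularMobius ≃ₜ UnitSphere × UnitBall :=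
  homeomorphOfIsQuotientMap (f := ⟨toRegularMobius, isQuotientMap_toRegularMobius.continuous⟩)
    (g := ⟨fun A => (Sp11.coord A).2, continuous_snd.comp Sp11.coord.continuous⟩)
    isQuotientMap_toRegularMobius
    (isOpenMap_snd.isQuotientMap continuous_snd Prod.snd_surjective |>.comp
      Sp11.coord.isQuotientMap) toRegularMobius_eq_iff

theorem RegularMobius.coord_toRegularMobius (A : Sp11) :
    RegularMobius.coord (toRegularMobius A) = (Sp11.coord A).2 :=
  homeomorphOfIsQuotientMap_apply _ _ _ A

theorem RegularMobius.apply_eq (F : RegularMobius) (q : UnitBall) {T : ℍ[ℝ]}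
    (hT : T - q * T * star ((coord F).2 : ℍ[ℝ]) = 1) :
    (F q : ℍ[ℝ]) = (q * T - T * (coord F).2) * star ((coord F).1 : ℍ[ℝ]) := by
  obtain ⟨A, rfl⟩ := isQuotientMap_toRegularMobius.surjective F
  rw [coord_toRegularMobius] at hT ⊢
  exact toRegularMobius_apply A q hT

theorem inverseOrbit_eq (F : RegularMobius) : inverseOrbit F = (RegularMobius.coord F).2 := by
  obtain ⟨A, rfl⟩ := isQuotientMap_toRegularMobius.surjective F
  rw [inverseOrbit_toRegularMobius, RegularMobius.coord_toRegularMobius]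
  rfl

theorem Isotropy.coord_incl_snd (g : Isotropy) : (RegularMobius.coord g.incl).2 = origin := by
  rw [← inverseOrbit_eq, inverseOrbit_eq_iff]
  exact g.map_origin

/-- The coordinate `u` identifies the isotropy `𝓜(𝔹)₀ = {q ↦ q u*}` with `Sp(1)`. -/
def Isotropy.coord : Isotropy ≃ₜ UnitSphere where
  toFun g := (RegularMobius.coord g.incl).1
  invFun u := ⟨RegularMobius.coord.symm (u, origin), by
    rw [← inverseOrbit_eq_iff, inverseOrbit_eq, Homeomorph.apply_symm_apply]⟩
  left_inv g := Subtype.ext <| (Homeomorph.symm_apply_eq _).mpr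
    (Prod.ext rfl g.coord_incl_snd.symm)
  right_inv u := congrArg Prod.fst (RegularMobius.coord.apply_symm_apply (u, origin))
  continuous_toFun := (RegularMobius.coord.continuous.comp continuous_induced_dom).fst
  continuous_invFun := continuous_induced_rng.mpr
    (RegularMobius.coord.symm.continuous.comp (Continuous.prodMk_left origin))

namespace Isotropy

theorem coord_incl (g : Isotropy) : RegularMobius.coord g.incl = (coord g, origin) :=
  Prod.ext rfl g.coord_incl_snd

theorem apply_eq (g : Isotropy) (q : UnitBall) :
    (g q : ℍ[ℝ]) = q * star (coord g : ℍ[ℝ]) := by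
  have h := RegularMobius.apply_eq g.incl q (T := 1) (by simp [coord_incl, origin])
  simpa [coord_incl, origin] using h

theorem coord_smul (g : Isotropy) (F : RegularMobius) :
    RegularMobius.coord (g • F) =
      (coord g * (RegularMobius.coord F).1, (RegularMobius.coord F).2) := by
  rw [← Homeomorph.eq_symm_apply]
  set G := RegularMobius.coord.symm
    (coord g * (RegularMobius.coord F).1, (RegularMobius.coord F).2) with hG
  have hcoord := (Homeomorph.eq_symm_apply _).mp hG
  refine RegularMobius.ext fun q => Subtype.ext ?_
  obtain ⟨T, hT⟩ := exists_sub_mul_mul_star_eq_one (RegularMobius.coord F).2 q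
  rw [smul_apply, apply_eq, F.apply_eq q hT, G.apply_eq q (by rwa [hcoord]), hcoord]
  simp [mul_assoc]

theorem coord_mul (g h : Isotropy) : coord (g * h) = coord g * coord h :=
  congrArg Prod.fst (coord_smul g h.incl)

theorem coord_one : coord 1 = 1 := by
  simpa using coord_mul 1 1

theorem eq_one_of_smul_eq (g : Isotropy) (F : RegularMobius) (h : g • F = F) : g = 1 := by
  have hfst := congrArg Prod.fst (coord_smul g F)
  rw [h] at hfst
  exact coord.injective ((right_eq_mul.mp hfst).trans coord_one.symm)

end Isotropy

theorem orbitProj_eq_iff (F G : RegularMobius) :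
    orbitProj F = orbitProj G ↔ (RegularMobius.coord F).2 = (RegularMobius.coord G).2 := by
  refine Quotient.eq.trans ⟨?_, fun h => ?_⟩
  · rintro ⟨g, rfl⟩
    change (RegularMobius.coord (g • G)).2 = _
    rw [Isotropy.coord_smul]
  · refine ⟨Isotropy.coord.symm ((RegularMobius.coord F).1 * (RegularMobius.coord G).1⁻¹),
      RegularMobius.coord.injective ?_⟩
    refine (Isotropy.coord_smul _ G).trans (Prod.ext ?_ h.symm)
    rw [Homeomorph.apply_symm_apply, inv_mul_cancel_right]

theorem isQuotientMap_orbitProj : Topology.IsQuotientMap orbitProj := isQuotientMap_quotient_mk'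

/-- The identification `𝓜(𝔹)₀ 𝓕 ↦ 𝓕⁻¹(0)` of the orbit space with the unit ball. -/
def OrbitSpace.coord : OrbitSpace ≃ₜ UnitBall :=
  homeomorphOfIsQuotientMap (f := ⟨orbitProj, isQuotientMap_orbitProj.continuous⟩)
    (g := ⟨fun F => (RegularMobius.coord F).2, continuous_snd.comp RegularMobius.coord.continuous⟩)
    isQuotientMap_orbitProj
    (isOpenMap_snd.isQuotientMap continuous_snd Prod.snd_surjective |>.comp
      RegularMobius.coord.isQuotientMap) orbitProj_eq_iff

theorem OrbitSpace.coord_orbitProj (F : RegularMobius) :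
    OrbitSpace.coord (orbitProj F) = (RegularMobius.coord F).2 :=
  homeomorphOfIsQuotientMap_apply _ _ _ F

theorem properSMul_of_compactSpace {G X : Type*} [TopologicalSpace G] [CompactSpace G] [Group G]
    [TopologicalSpace X] [T2Space X] [MulAction G X] [ContinuousSMul G X] : ProperSMul G X where
  isProperMap_smul_pair := isProperMap_of_comp_of_t2 (by fun_prop) continuous_snd
    isProperMap_snd_of_compactSpace

instance : T2Space RegularMobius := RegularMobius.coord.symm.t2Space

instance : SecondCountableTopology RegularMobius := RegularMobius.coord.secondCountableTopology

instance : CompactSpace Isotropy := Isotropy.coord.symm.compactSpace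

theorem Isotropy.smul_eq (g : Isotropy) (F : RegularMobius) :
    g • F = RegularMobius.coord.symm
      (coord g * (RegularMobius.coord F).1, (RegularMobius.coord F).2) :=
  (Homeomorph.eq_symm_apply _).mpr (coord_smul g F)

instance : ContinuousSMul Isotropy RegularMobius where
  continuous_smul := by
    have hF : Continuous fun p : Isotropy × RegularMobius => RegularMobius.coord p.2 :=
      RegularMobius.coord.continuous.comp continuous_snd
    have hg : Continuous fun p : Isotropy × RegularMobius => Isotropy.coord p.1 :=
      Isotropy.coord.continuous.comp continuous_fst
    exact (RegularMobius.coord.symm.continuous.comp ((hg.mul hF.fst).prodMk hF.snd)).congr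
      fun p => (Isotropy.smul_eq p.1 p.2).symm

instance : ProperSMul Isotropy RegularMobius := properSMul_of_compactSpace

/-! ### Smoothness of the coordinates -/

section
variable {𝕜 : Type*} [NontriviallyNormedField 𝕜] {R : Type*} [NormedDivisionRing R]
  [NormedAlgebra 𝕜 R] [HasSummableGeomSeries R]

theorem contDiffAt_inv_of_normedDivisionRing {n : ℕ∞ω} {x : R} (hx : x ≠ 0) :
    ContDiffAt 𝕜 n Inv.inv x := by
  simpa only [Ring.inverse_eq_inv'] using! contDiffAt_ringInverse 𝕜 (Units.mk0 x hx)

end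

section
variable {𝕜 : Type*} [NontriviallyNormedField 𝕜]
  {E : Type*} [NormedAddCommGroup E] [NormedSpace 𝕜 E]
  {H : Type*} [TopologicalSpace H] {I : ModelWithCorners 𝕜 E H}
  {M : Type*} [TopologicalSpace M] [ChartedSpace H M]

theorem mfderiv_coe_opens_injective [IsManifold I 1 M] (U : TopologicalSpace.Opens M) (x : U) :
    Function.Injective (mfderiv I I (Subtype.val : U → M) x) := by
  have : Nonempty U := ⟨x⟩
  let r : M → U := Function.invFun Subtype.val
  have hr : r ∘ Subtype.val = id :=
    (Function.leftInverse_invFun Subtype.val_injective).comp_eq_id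
  have hr_smooth : ContMDiffAt I I 1 r x :=
    contMDiffAt_subtype_iff.mp (contMDiffAt_id.congr_of_eventuallyEq (.of_eq hr))
  refine mfderiv_injective_of_comp (hr_smooth.mdifferentiableAt one_ne_zero)
    ((contMDiff_subtype_val (n := 1) x).mdifferentiableAt one_ne_zero) ?_
  rw [hr, mfderiv_id]
  exact Function.injective_id

end

instance : Fact (Module.finrank ℝ ℍ[ℝ] = 3 + 1) := ⟨Quaternion.finrank_eq_four⟩

theorem contDiff_star_quaternion {n : ℕ∞ω} : ContDiff ℝ n (star : ℍ[ℝ] → ℍ[ℝ]) :=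
  (starL' ℝ : ℍ[ℝ] ≃L[ℝ] ℍ[ℝ]).contDiff

theorem contDiffAt_boostFactor {n : ℕ∞ω} (p : UnitBall) :
    ContDiffAt ℝ n boostFactor (p : ℍ[ℝ]) := by
  have hpos := one_sub_norm_sq_pos p
  exact ((contDiffAt_const.sub (contDiff_norm_sq ℝ).contDiffAt).sqrt hpos.ne').inv
    (Real.sqrt_pos.mpr hpos).ne'

section
variable {E H M : Type*} [NormedAddCommGroup E] [NormedSpace ℝ E] [TopologicalSpace H]
  {I : ModelWithCorners ℝ E H} [TopologicalSpace M] [ChartedSpace H M]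

theorem contMDiff_quaternion_mul {n : ℕ∞ω} {f g : M → ℍ[ℝ]} (hf : ContMDiff I 𝓘(ℝ, ℍ[ℝ]) n f)
    (hg : ContMDiff I 𝓘(ℝ, ℍ[ℝ]) n g) : ContMDiff I 𝓘(ℝ, ℍ[ℝ]) n fun x => f x * g x :=
  (contDiff_mul (𝕜 := ℝ) (𝔸 := ℍ[ℝ])).comp_contMDiff (hf.prodMk_space hg)

theorem contMDiff_unitSphere_of_coe [IsManifold I ∞ M] {f : M → UnitSphere}
    (hf : ContMDiff I 𝓘(ℝ, ℍ[ℝ]) ∞ fun x => (f x : ℍ[ℝ])) : ContMDiff I (𝓡 3) ∞ f :=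
  hf.codRestrict_sphere fun x => (f x).2

end

instance : LieGroup (𝓡 3) ∞ UnitSphere where
  contMDiff_mul := contMDiff_unitSphere_of_coe (contMDiff_quaternion_mul
    (contMDiff_coe_sphere.comp contMDiff_fst) (contMDiff_coe_sphere.comp contMDiff_snd))
  contMDiff_inv := contMDiff_unitSphere_of_coe
    ((contDiff_star_quaternion.comp_contMDiff contMDiff_coe_sphere).congr UnitSphere.coe_inv)

/-- The product model of `Sp(1) × 𝔹`. -/
abbrev mobiusModel := (𝓡 3).prod 𝓘(ℝ, ℍ[ℝ])

/-- The product model of `Sp(1) × Sp(1) × 𝔹`. -/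
abbrev sp11Model := (𝓡 3).prod mobiusModel

namespace Sp11

theorem contMDiff_incl_ofCoords :
    ContMDiff sp11Model 𝓘(ℝ, Fin 2 → Fin 2 → ℍ[ℝ]) ∞ fun x => incl (ofCoords x) := by
  have hv : ContMDiff sp11Model 𝓘(ℝ, ℍ[ℝ]) ∞
      fun x : UnitSphere × UnitSphere × UnitBall => (x.1 : ℍ[ℝ]) :=
    contMDiff_coe_sphere.comp contMDiff_fst
  have hu : ContMDiff sp11Model 𝓘(ℝ, ℍ[ℝ]) ∞
      fun x : UnitSphere × UnitSphere × UnitBall => (x.2.1 : ℍ[ℝ]) :=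
    contMDiff_coe_sphere.comp (contMDiff_fst.comp contMDiff_snd)
  have hp : ContMDiff sp11Model 𝓘(ℝ, ℍ[ℝ]) ∞
      fun x : UnitSphere × UnitSphere × UnitBall => (x.2.2 : ℍ[ℝ]) :=
    contMDiff_subtype_val.comp (contMDiff_snd.comp contMDiff_snd)
  have hstar : ContMDiff sp11Model 𝓘(ℝ, ℍ[ℝ]) ∞
      fun x : UnitSphere × UnitSphere × UnitBall => star (x.2.2 : ℍ[ℝ]) :=
    contDiff_star_quaternion.comp_contMDiff hp
  have hβ : ContMDiff sp11Model 𝓘(ℝ, ℝ) ∞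
      fun x : UnitSphere × UnitSphere × UnitBall => boostFactor x.2.2 :=
    fun x => ContDiffAt.comp_contMDiffAt (g := boostFactor)
      (f := fun y : UnitSphere × UnitSphere × UnitBall => (y.2.2 : ℍ[ℝ]))
      (contDiffAt_boostFactor x.2.2) (hp x)
  have hmatrix : ContMDiff sp11Model 𝓘(ℝ, Fin 2 → Fin 2 → ℍ[ℝ]) ∞
      fun x : UnitSphere × UnitSphere × UnitBall => (fun i j => boostFactor x.2.2 •
        !![(x.2.1 : ℍ[ℝ]) * x.1, x.2.1 * star (x.2.2 : ℍ[ℝ]) * x.1; x.2.2 * x.1, x.1] i j) := by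
    refine contMDiff_pi_space.mpr fun i => contMDiff_pi_space.mpr fun j => hβ.smul ?_
    fin_cases i <;> fin_cases j
    exacts [contMDiff_quaternion_mul hu hv,
      contMDiff_quaternion_mul (contMDiff_quaternion_mul hu hstar) hv,
      contMDiff_quaternion_mul hp hv, hv]
  exact hmatrix.congr fun x => coe_ofCoords x.1 x.2.1 x.2.2

/-- The coordinates of `Sp(1,1)` as functions on all matrices. They are smooth where `d ≠ 0`. -/
def ambientCoord (X : Fin 2 → Fin 2 → ℍ[ℝ]) : ℍ[ℝ] × ℍ[ℝ] × ℍ[ℝ] :=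
  (‖X 1 1‖⁻¹ • X 1 1, X 0 0 * (X 1 1)⁻¹, X 1 0 * (X 1 1)⁻¹)

theorem contMDiffAt_ambientCoord {X : Fin 2 → Fin 2 → ℍ[ℝ]} (hX : X 1 1 ≠ 0) :
    ContMDiffAt 𝓘(ℝ, Fin 2 → Fin 2 → ℍ[ℝ]) (𝓘(ℝ, ℍ[ℝ]).prod (𝓘(ℝ, ℍ[ℝ]).prod 𝓘(ℝ, ℍ[ℝ]))) ∞
      ambientCoord X := by
  have hentry (i j : Fin 2) : ContDiffAt ℝ ∞ (fun Y : Fin 2 → Fin 2 → ℍ[ℝ] => Y i j) X :=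
    (contDiff_apply_apply ℝ ℍ[ℝ] i j).contDiffAt
  have hinv : ContDiffAt ℝ ∞ (fun Y : Fin 2 → Fin 2 → ℍ[ℝ] => (Y 1 1)⁻¹) X :=
    (contDiffAt_inv_of_normedDivisionRing hX).comp X (hentry 1 1)
  have hnorm : ContDiffAt ℝ ∞ (fun Y : Fin 2 → Fin 2 → ℍ[ℝ] => ‖Y 1 1‖⁻¹) X :=
    ((hentry 1 1).norm ℝ hX).inv (norm_ne_zero_iff.mpr hX)
  exact (hnorm.smul (hentry 1 1)).contMDiffAt.prodMk
    (((hentry 0 0).mul hinv).contMDiffAt.prodMk ((hentry 1 0).mul hinv).contMDiffAt)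

/-- The inclusion of the coordinate domain `Sp(1) × Sp(1) × 𝔹` into `ℍ³`. -/
def coordIncl : UnitSphere × UnitSphere × UnitBall → ℍ[ℝ] × ℍ[ℝ] × ℍ[ℝ] :=
  Prod.map Subtype.val (Prod.map Subtype.val Subtype.val)

theorem ambientCoord_comp_incl : ambientCoord ∘ incl = coordIncl ∘ coord := rfl

theorem contMDiff_coordIncl :
    ContMDiff sp11Model (𝓘(ℝ, ℍ[ℝ]).prod (𝓘(ℝ, ℍ[ℝ]).prod 𝓘(ℝ, ℍ[ℝ]))) ∞ coordIncl :=
  contMDiff_coe_sphere.prodMap (contMDiff_coe_sphere.prodMap contMDiff_subtype_val)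

theorem mfderiv_coordIncl_injective (x : UnitSphere × UnitSphere × UnitBall) :
    Function.Injective
      (mfderiv sp11Model (𝓘(ℝ, ℍ[ℝ]).prod (𝓘(ℝ, ℍ[ℝ]).prod 𝓘(ℝ, ℍ[ℝ]))) coordIncl x) := by
  have hsphere (u : UnitSphere) :
      MDifferentiableAt (𝓡 3) 𝓘(ℝ, ℍ[ℝ]) (Subtype.val : UnitSphere → ℍ[ℝ]) u :=
    (contMDiff_coe_sphere (m := 1) u).mdifferentiableAt one_ne_zero
  have hball : MDifferentiableAt 𝓘(ℝ, ℍ[ℝ]) 𝓘(ℝ, ℍ[ℝ]) (Subtype.val : UnitBall → ℍ[ℝ]) x.2.2 :=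
    (contMDiff_subtype_val (n := 1) x.2.2).mdifferentiableAt one_ne_zero
  have hpair : MDifferentiableAt ((𝓡 3).prod 𝓘(ℝ, ℍ[ℝ])) (𝓘(ℝ, ℍ[ℝ]).prod 𝓘(ℝ, ℍ[ℝ]))
      (Prod.map Subtype.val Subtype.val : UnitSphere × UnitBall → ℍ[ℝ] × ℍ[ℝ]) x.2 :=
    (hsphere x.2.1).prodMap hball
  rw [coordIncl, mfderiv_prodMap (hsphere x.1) hpair, mfderiv_prodMap (hsphere x.2.1) hball]
  exact (injective_mvfderiv_subtypeVal_sphere x.1).prodMap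
    ((injective_mvfderiv_subtypeVal_sphere x.2.1).prodMap
      (mfderiv_coe_opens_injective (I := 𝓘(ℝ, ℍ[ℝ])) UnitBall x.2.2))

section
variable {E H : Type*} [NormedAddCommGroup E] [NormedSpace ℝ E] [TopologicalSpace H]
  {I : ModelWithCorners ℝ E H} [ChartedSpace H Sp11]

theorem contMDiff_coord [IsManifold I ∞ Sp11]
    (h : ContMDiff I 𝓘(ℝ, Fin 2 → Fin 2 → ℍ[ℝ]) ∞ incl) : ContMDiff I sp11Model ∞ coord := by
  have hcoord : ContMDiff I (𝓘(ℝ, ℍ[ℝ]).prod (𝓘(ℝ, ℍ[ℝ]).prod 𝓘(ℝ, ℍ[ℝ]))) ∞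
      (coordIncl ∘ coord) := fun A =>
    (contMDiffAt_ambientCoord (denom_ne_zero A)).comp A (h A)
  have hphase : ContMDiff I (𝓡 3) ∞ phase :=
    contMDiff_unitSphere_of_coe (contMDiff_fst.comp hcoord)
  have htwist : ContMDiff I (𝓡 3) ∞ twist :=
    contMDiff_unitSphere_of_coe (contMDiff_fst.comp (contMDiff_snd.comp hcoord))
  have hroot : ContMDiff I 𝓘(ℝ, ℍ[ℝ]) ∞ root :=
    (ContMDiff.subtypeVal_comp_iff UnitBall root).mp
      (contMDiff_snd.comp (contMDiff_snd.comp hcoord))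
  exact hphase.prodMk (htwist.prodMk hroot)

theorem mfderiv_incl_injective (Φ : Sp11 ≃ₘ^∞⟮I, sp11Model⟯ (UnitSphere × UnitSphere × UnitBall))
    (hΦ : ⇑Φ = coord) (h : ContMDiff I 𝓘(ℝ, Fin 2 → Fin 2 → ℍ[ℝ]) ∞ incl) (A : Sp11) :
    Function.Injective (mfderiv I 𝓘(ℝ, Fin 2 → Fin 2 → ℍ[ℝ]) incl A) := by
  refine mfderiv_injective_of_comp
    ((contMDiffAt_ambientCoord (denom_ne_zero A)).mdifferentiableAt (by simp))
    (h.mdifferentiable (by simp) A) ?_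
  rw [ambientCoord_comp_incl, ← hΦ,
    mfderiv_comp A (contMDiff_coordIncl.mdifferentiable (by simp) (Φ A))
      (Φ.mdifferentiable (by simp) A)]
  exact (mfderiv_coordIncl_injective (Φ A)).comp
    (Φ.mfderivToContinuousLinearEquiv (by simp) A).injective

end

end Sp11

section
variable {E : Type*} [NormedAddCommGroup E] [NormedSpace ℝ E] [CompleteSpace E]
  [ChartedSpace E Sp11] [IsManifold 𝓘(ℝ, E) ∞ Sp11]

/-- The coordinates of `Sp(1,1)` as a diffeomorphism, for any structure of embedded submanifold
of `M₂(ℍ)`. -/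
def Sp11.diffeomorph (hSp : IsEmbeddingOfManifolds E (Fin 2 → Fin 2 → ℍ[ℝ]) Sp11.incl) :
    Sp11 ≃ₘ^∞⟮𝓘(ℝ, E), sp11Model⟯ (UnitSphere × UnitSphere × UnitBall) :=
  hSp.diffeomorph Sp11.coord.toEquiv (Sp11.contMDiff_coord hSp.contMDiff)
    Sp11.contMDiff_incl_ofCoords

/-- The coordinates of `𝓜(𝔹)` as a diffeomorphism, for any manifold structure for which
`Sp(1,1) → 𝓜(𝔹)` is a submersion. -/
def RegularMobius.diffeomorph {F : Type*} [NormedAddCommGroup F] [NormedSpace ℝ F]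
    [FiniteDimensional ℝ F] [ChartedSpace F RegularMobius]
    (hSp : IsEmbeddingOfManifolds E (Fin 2 → Fin 2 → ℍ[ℝ]) Sp11.incl)
    (hM : IsSmoothSubmersion E F toRegularMobius) :
    RegularMobius ≃ₘ^∞⟮𝓘(ℝ, F), mobiusModel⟯ (UnitSphere × UnitBall) :=
  hM.diffeomorph (Sp11.diffeomorph hSp) RegularMobius.coord.toEquiv
    RegularMobius.coord_toRegularMobius

end

theorem exists_chartedSpace_Sp11 :
    ∃ _ : ChartedSpace (Model 10) Sp11, IsManifold (𝓡 10) ∞ Sp11 ∧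
      IsEmbeddingOfManifolds (Model 10) (Fin 2 → Fin 2 → ℍ[ℝ]) Sp11.incl := by
  have hdim : Module.finrank ℝ (Model 3 × Model 3 × ℍ[ℝ]) = Module.finrank ℝ (Model 10) := by
    simp [Quaternion.finrank_eq_four]
  obtain ⟨_, hmanifold, Φ, hΦ⟩ := exists_chartedSpace_diffeomorph (n := ∞) (I := sp11Model)
    Sp11.coord (ContinuousLinearEquiv.ofFinrankEq hdim)
  have hincl : ContMDiff (𝓡 10) 𝓘(ℝ, Fin 2 → Fin 2 → ℍ[ℝ]) ∞ Sp11.incl :=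
    (Sp11.contMDiff_incl_ofCoords.comp Φ.contMDiff).congr fun A => by
      rw [Function.comp_apply, hΦ]
      exact congrArg Sp11.incl (Sp11.coord.symm_apply_apply A).symm
  exact ⟨_, hmanifold, hincl, Topology.IsEmbedding.subtypeVal,
    Sp11.mfderiv_incl_injective Φ hΦ hincl⟩

theorem exists_chartedSpace_RegularMobius {E : Type*} [NormedAddCommGroup E] [NormedSpace ℝ E]
    [ChartedSpace E Sp11]
    (Φ : Sp11 ≃ₘ^∞⟮𝓘(ℝ, E), sp11Model⟯ (UnitSphere × UnitSphere × UnitBall))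
    (hΦ : ⇑Φ = Sp11.coord) :
    ∃ _ : ChartedSpace (Model 7) RegularMobius, IsManifold (𝓡 7) ∞ RegularMobius ∧
      IsSmoothSubmersion E (Model 7) toRegularMobius := by
  have hdim : Module.finrank ℝ (Model 3 × ℍ[ℝ]) = Module.finrank ℝ (Model 7) := by
    simp [Quaternion.finrank_eq_four]
  obtain ⟨_, hmanifold, Ψ, hΨ⟩ := exists_chartedSpace_diffeomorph (n := ∞) (I := mobiusModel)
    RegularMobius.coord (ContinuousLinearEquiv.ofFinrankEq hdim)
  refine ⟨_, hmanifold, isSmoothSubmersion_of_diffeomorph_prod Φ Ψ fun A => ?_⟩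
  rw [hΦ, hΨ, RegularMobius.coord_toRegularMobius]

section
variable {E : Type*} [NormedAddCommGroup E] [NormedSpace ℝ E] [ChartedSpace E RegularMobius]
  (Φ : RegularMobius ≃ₘ^∞⟮𝓘(ℝ, E), mobiusModel⟯ (UnitSphere × UnitBall))
  (hΦ : ⇑Φ = RegularMobius.coord)

include hΦ

theorem RegularMobius.contMDiff_coord : ContMDiff 𝓘(ℝ, E) mobiusModel ∞ coord :=
  hΦ ▸ Φ.contMDiff

theorem RegularMobius.contMDiff_coord_symm : ContMDiff mobiusModel 𝓘(ℝ, E) ∞ coord.symm :=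
  Φ.symm.contMDiff.congr fun x => coord.symm_apply_eq.mpr (by rw [← hΦ, Φ.apply_symm_apply])

theorem contMDiff_inverseOrbit : ContMDiff 𝓘(ℝ, E) 𝓘(ℝ, ℍ[ℝ]) ∞ inverseOrbit :=
  (contMDiff_snd.comp (RegularMobius.contMDiff_coord Φ hΦ)).congr inverseOrbit_eq

theorem exists_chartedSpace_Isotropy :
    ∃ _ : ChartedSpace (Model 3) Isotropy, IsManifold (𝓡 3) ∞ Isotropy ∧
      IsEmbeddingOfManifolds (Model 3) E Isotropy.incl := by
  obtain ⟨_, hmanifold, Ψ, hΨ⟩ := exists_chartedSpace_diffeomorph (n := ∞) (I := 𝓡 3)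
    Isotropy.coord (ContinuousLinearEquiv.refl ℝ (Model 3))
  have hincl : ContMDiff (𝓡 3) 𝓘(ℝ, E) ∞ Isotropy.incl :=
    ((RegularMobius.contMDiff_coord_symm Φ hΦ).comp
      (Ψ.contMDiff.prodMk contMDiff_const)).congr fun g => by
        rw [Function.comp_apply, hΨ, ← Isotropy.coord_incl, Homeomorph.symm_apply_apply]
  have hleft : Function.LeftInverse (fun F => Ψ.symm (RegularMobius.coord F).1) Isotropy.incl :=
    fun g => by
      dsimp only
      rw [Isotropy.coord_incl, ← hΨ, Ψ.symm_apply_apply]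
  exact ⟨_, hmanifold, isEmbeddingOfManifolds_of_leftInverse hincl (Ψ.symm.contMDiff.comp
    (contMDiff_fst.comp (RegularMobius.contMDiff_coord Φ hΦ))) hleft⟩

theorem exists_chartedSpace_OrbitSpace :
    ∃ _ : ChartedSpace (Model 4) OrbitSpace, IsManifold (𝓡 4) ∞ OrbitSpace ∧
      IsSmoothSubmersion E (Model 4) orbitProj := by
  have hdim : Module.finrank ℝ ℍ[ℝ] = Module.finrank ℝ (Model 4) := by
    simp [Quaternion.finrank_eq_four]
  obtain ⟨_, hmanifold, Ψ, hΨ⟩ := exists_chartedSpace_diffeomorph (n := ∞) (I := 𝓘(ℝ, ℍ[ℝ]))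
    OrbitSpace.coord (ContinuousLinearEquiv.ofFinrankEq hdim)
  refine ⟨_, hmanifold, isSmoothSubmersion_of_diffeomorph_prod Φ Ψ fun F => ?_⟩
  rw [hΦ, hΨ, OrbitSpace.coord_orbitProj]

end

section
variable {E : Type*} [NormedAddCommGroup E] [NormedSpace ℝ E] [ChartedSpace E RegularMobius]
  {F : Type*} [NormedAddCommGroup F] [NormedSpace ℝ F] [ChartedSpace F Isotropy]
  (Φ : RegularMobius ≃ₘ^∞⟮𝓘(ℝ, E), mobiusModel⟯ (UnitSphere × UnitBall))
  (hΦ : ⇑Φ = RegularMobius.coord)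

include hΦ

theorem Isotropy.contMDiff_coord (h : IsEmbeddingOfManifolds F E Isotropy.incl) :
    ContMDiff 𝓘(ℝ, F) (𝓡 3) ∞ coord :=
  (contMDiff_fst.comp ((RegularMobius.contMDiff_coord Φ hΦ).comp h.contMDiff)).congr fun g => by
    rw [Function.comp_apply, Function.comp_apply, coord_incl]

theorem lieGroup_Isotropy [CompleteSpace F] [FiniteDimensional ℝ E] [IsManifold 𝓘(ℝ, F) ∞ Isotropy]
    (h : IsEmbeddingOfManifolds F E Isotropy.incl) : LieGroup 𝓘(ℝ, F) ∞ Isotropy := by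
  have hincl_coord_symm : ContMDiff (𝓡 3) 𝓘(ℝ, E) ∞ (Isotropy.incl ∘ Isotropy.coord.symm) := by
    refine ((RegularMobius.contMDiff_coord_symm Φ hΦ).comp
      (contMDiff_id.prodMk (contMDiff_const (c := origin)))).congr fun u => ?_
    refine (RegularMobius.coord.symm_apply_eq.mpr ?_).symm
    rw [Function.comp_apply, Isotropy.coord_incl, Homeomorph.apply_symm_apply]
    rfl
  exact lieGroup_of_diffeomorph
    (h.diffeomorph Isotropy.coord.toEquiv (Isotropy.contMDiff_coord Φ hΦ h) hincl_coord_symm)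
    Isotropy.coord_mul

theorem contMDiff_smul_Isotropy (h : IsEmbeddingOfManifolds F E Isotropy.incl) :
    ContMDiff (𝓘(ℝ, F).prod 𝓘(ℝ, E)) 𝓘(ℝ, E) ∞ fun p : Isotropy × RegularMobius => p.1 • p.2 := by
  have hg : ContMDiff (𝓘(ℝ, F).prod 𝓘(ℝ, E)) (𝓡 3) ∞
      fun p : Isotropy × RegularMobius => Isotropy.coord p.1 :=
    (Isotropy.contMDiff_coord Φ hΦ h).comp contMDiff_fst
  have hF : ContMDiff (𝓘(ℝ, F).prod 𝓘(ℝ, E)) mobiusModel ∞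
      fun p : Isotropy × RegularMobius => RegularMobius.coord p.2 :=
    (RegularMobius.contMDiff_coord Φ hΦ).comp contMDiff_snd
  exact ((RegularMobius.contMDiff_coord_symm Φ hΦ).comp ((hg.mul (contMDiff_fst.comp hF)).prodMk
    (contMDiff_snd.comp hF))).congr fun p => Isotropy.smul_eq p.1 p.2

end

/-- The homeomorphism `𝓜(𝔹)₀\𝓜(𝔹) ≅ 𝔹` as a diffeomorphism, for any manifold structure for which
`𝓜(𝔹) → 𝓜(𝔹)₀\𝓜(𝔹)` is a submersion. -/
def OrbitSpace.diffeomorph {E : Type*} [NormedAddCommGroup E] [NormedSpace ℝ E] [CompleteSpace E]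
    [ChartedSpace E RegularMobius] [IsManifold 𝓘(ℝ, E) ∞ RegularMobius]
    {F : Type*} [NormedAddCommGroup F] [NormedSpace ℝ F] [FiniteDimensional ℝ F]
    [ChartedSpace F OrbitSpace]
    (Φ : RegularMobius ≃ₘ^∞⟮𝓘(ℝ, E), mobiusModel⟯ (UnitSphere × UnitBall))
    (hΦ : ⇑Φ = RegularMobius.coord) (h : IsSmoothSubmersion E F orbitProj) :
    OrbitSpace ≃ₘ^∞⟮𝓘(ℝ, F), 𝓘(ℝ, ℍ[ℝ])⟯ UnitBall :=
  h.diffeomorph Φ OrbitSpace.coord.toEquiv fun G => by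
    rw [hΦ]
    exact OrbitSpace.coord_orbitProj G

end SliceMobius

end

theorem mainTheorem4 :
    -- the left action of the isotropy on `𝓜(𝔹)` by composition is free and proper
    (∀ (g : Isotropy) (F : RegularMobius), g • F = F → g = 1) ∧
    (∀ K : Set RegularMobius, IsCompact K →
      IsCompact {g : Isotropy | (((fun F => g • F) '' K) ∩ K).Nonempty}) ∧
    T2Space RegularMobius ∧ SecondCountableTopology RegularMobius ∧
    -- `Sp(1,1)` is an embedded submanifold of `M₂(ℍ)`, of dimension 10
    (∃ _ : ChartedSpace (Model 10) Sp11, IsManifold (𝓡 10) ∞ Sp11 ∧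
      IsEmbeddingOfManifolds (Model 10) (Fin 2 → Fin 2 → ℍ[ℝ]) Sp11.incl) ∧
    ∀ [ChartedSpace (Model 10) Sp11] [IsManifold (𝓡 10) ∞ Sp11],
      IsEmbeddingOfManifolds (Model 10) (Fin 2 → Fin 2 → ℍ[ℝ]) Sp11.incl →
      -- the manifold structure of `𝓜(𝔹)` as a quotient of `Sp(1,1)`, of dimension 7
      (∃ _ : ChartedSpace (Model 7) RegularMobius, IsManifold (𝓡 7) ∞ RegularMobius ∧
        IsSmoothSubmersion (Model 10) (Model 7) toRegularMobius) ∧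
      ∀ [ChartedSpace (Model 7) RegularMobius] [IsManifold (𝓡 7) ∞ RegularMobius],
        IsSmoothSubmersion (Model 10) (Model 7) toRegularMobius →
        -- the inverse orbit map is smooth
        ContMDiff (𝓡 7) 𝓘(ℝ, ℍ[ℝ]) ∞ inverseOrbit ∧
        -- the isotropy is an embedded submanifold of `𝓜(𝔹)`, a Lie group, and acts smoothly
        (∃ _ : ChartedSpace (Model 3) Isotropy, IsManifold (𝓡 3) ∞ Isotropy ∧
          IsEmbeddingOfManifolds (Model 3) (Model 7) Isotropy.incl) ∧
        (∀ [ChartedSpace (Model 3) Isotropy] [IsManifold (𝓡 3) ∞ Isotropy],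
          IsEmbeddingOfManifolds (Model 3) (Model 7) Isotropy.incl →
          LieGroup (𝓡 3) ∞ Isotropy ∧
          ContMDiff ((𝓡 3).prod (𝓡 7)) (𝓡 7) ∞
            (fun p : Isotropy × RegularMobius => p.1 • p.2)) ∧
        -- the manifold structure of the orbit space, of dimension 4
        (∃ _ : ChartedSpace (Model 4) OrbitSpace, IsManifold (𝓡 4) ∞ OrbitSpace ∧
          IsSmoothSubmersion (Model 7) (Model 4) orbitProj) ∧
        -- the inverse orbit map induces a diffeomorphism of the orbit space onto the ball
        ∀ [ChartedSpace (Model 4) OrbitSpace] [IsManifold (𝓡 4) ∞ OrbitSpace],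
          IsSmoothSubmersion (Model 7) (Model 4) orbitProj →
          ∃ Φ : Diffeomorph (𝓡 4) 𝓘(ℝ, ℍ[ℝ]) OrbitSpace UnitBall ∞,
            ∀ F : RegularMobius, Φ (orbitProj F) = inverseOrbit F := by
  refine ⟨Isotropy.eq_one_of_smul_eq,
    fun K hK => ProperSMul.isCompact_setOfPred_inter_nonempty hK hK,
    inferInstance, inferInstance, exists_chartedSpace_Sp11, ?_⟩
  intro _ _ hSp
  refine ⟨exists_chartedSpace_RegularMobius (Sp11.diffeomorph hSp) rfl, ?_⟩
  intro _ _ hM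
  let Φ := RegularMobius.diffeomorph hSp hM
  have hΦ : ⇑Φ = RegularMobius.coord := rfl
  refine ⟨contMDiff_inverseOrbit Φ hΦ, exists_chartedSpace_Isotropy Φ hΦ, ?_,
    exists_chartedSpace_OrbitSpace Φ hΦ, ?_⟩
  · intro _ _ hIsotropy
    exact ⟨lieGroup_Isotropy Φ hΦ hIsotropy, contMDiff_smul_Isotropy Φ hΦ hIsotropy⟩
  · intro _ _ hOrbit
    exact ⟨OrbitSpace.diffeomorph Φ hΦ hOrbit,
      fun F => (OrbitSpace.coord_orbitProj F).trans (inverseOrbit_eq F).symm⟩
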